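/- Let $\mu\in(0,1)$, $E=(-\tfrac12,0)$, $M=(\tfrac12,0)$, and consider on $(\mathbb R^2\setminus\{E,M\})\times\mathbb R^2$, with the symplectic form $\omega=\sum_j dp_j\wedge dq_j$, the Hamiltonian of the Euler problem of two fixed centers $$H(q,p)=\tfrac12|p|^2-\frac{1-\mu}{|q-E|}-\frac{\mu}{|q-M|}.$$ Let $c_J=-1-2\sqrt{\mu(1-\mu)}$ be its critical Jacobi energy (the value of $H$ at its unique critical point), and let $c<c_J$. Then the energy hypersurface $H^{-1}(c)$ has exactly two connected components $\Sigma_E\neq\Sigma_M$; together with $E$ (respectively $M$), the projection of $\Sigma_E$ (respectively $\Sigma_M$) to the $q$-plane is a neighborhood of $E$ (respectively $M$). For $A\in\{E,M\}$ the following hold. Let $T^*S^2=\{(\xi,\eta)\in\mathbb R^3\times\mathbb R^3: |\xi|=1,\ \xi\cdot\eta=0\}$, with the restriction of $\sum_j d\eta_j\wedge d\xi_j$, let $N=(1,0,0)$, and let $\Phi_A:\mathbb R^2\times\mathbb R^2\to T^*S^2$, $(q,p)\mapsto(\xi,\eta)$, be Moser's map: with $x=p$, $y=A-q$, $$\xi=\Big(\tfrac{|x|^2-1}{|x|^2+1},\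 \tfrac{2x}{|x|^2+1}\Big),\qquad \eta=\Big(x\cdot y,\ \tfrac{|x|^2+1}{2}\,y-(x\cdot y)\,x\Big).$$ Let $\overline\Sigma_A$ be the closure of $\Phi_A(\Sigma_A)$. 1. (Regularization.) $\Phi_A$ is smooth, injective and symplectic, with image $\{(\xi,\eta)\in T^*S^2:\xi\ne N\}$. The set $\overline\Sigma_A$ is a compact subset of $T^*S^2$, and $\overline\Sigma_A\cap\{\xi\neq N\}=\Phi_A(\Sigma_A)$. There are an open neighborhood $U$ of $\overline\Sigma_A$ and a smooth function $K$ on $U$ such that $\overline\Sigma_A$ is the zero set of $K$ in $U\cap T^*S^2$, the differential of $K|_{T^*S^2}$ vanishes at no point of $\overline\Sigma_A$, and $K\circ\Phi_A=|q-A|\,(H-c)$ wherever $q\ne E,M$ and $\Phi_A(q,p)\in U$. 2. $\overline\Sigma_A$ is a smooth three-dimensional submanifold of $T^*S^2$ which is diffeomorphic to $\mathbb{R}P^3$. 3. $\overline\Sigma_A$ is fiberwise star-shaped: it does not meet the zero section, and it meets every open ray $\{(\xi,t\eta):t>0\}$, $(\xi,\eta)\in T^*S^2$, $\eta\neq0$,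 in exactly one point. 4. $\overline\Sigma_A$ is of restricted contact type. The field $X_A=(q-A)\,\partial_q$ is a Liouville vector field ($\mathcal L_{X_A}\omega=\omega$) which is transverse to $\Sigma_A$. Under $\Phi_A$ it extends to the vector field $\eta\,\partial_\eta$ of $T^*S^2$, which is a Liouville vector field on $T^*S^2$ and is transverse to $\overline\Sigma_A$. -/

import Mathlib

open Metric
open scoped Manifold ContDiff Topology

namespace EulerProblem

/-- The two-element group `{1, -1}`, as the unit sphere of `ℝ`. -/
abbrev SignGroup : Type := sphere (0 : ℝ) 1
/-- The unit sphere of `ℝ⁴`, with the smooth structure that Mathlib gives to it. -/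
abbrev ThreeSphere : Type := sphere (0 : EuclideanSpace ℝ (Fin 4)) 1

theorem signGroup_eq (g : SignGroup) : (g : ℝ) = 1 ∨ (g : ℝ) = -1 := by
  have h : ‖(g : ℝ)‖ = 1 := norm_eq_of_mem_sphere g
  exact eq_or_eq_neg_of_abs_eq h

instance : Finite SignGroup := by
  refine Finite.of_injective (β := ({1, -1} : Set ℝ)) (fun g => ⟨g.1, ?_⟩) ?_
  · rcases signGroup_eq g with h | h <;> simp [h]
  · intro a b h
    exact Subtype.ext (by simpa using h)

instance : IsCancelSMul SignGroup ThreeSphere where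
  left_cancel' a b c h := MulAction.injective a h
  right_cancel' a b c h := by
    have h1 : (a : ℝ) • (c : EuclideanSpace ℝ (Fin 4)) = (b : ℝ) • (c : EuclideanSpace ℝ (Fin 4)) :=
      congrArg Subtype.val h
    have hc : (c : EuclideanSpace ℝ (Fin 4)) ≠ 0 := ne_zero_of_mem_unit_sphere c
    exact Subtype.ext (smul_left_injective ℝ hc h1)

/-- The real projective space `ℝP³`: the quotient of the unit sphere of `ℝ⁴` by `x ∼ -x`.
Its topology is the quotient topology, and its charts are the charts of the sphere, transported by
local inverses of the quotient map. -/
abbrev RealProjectiveThreeSpace : Type :=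
  MulAction.orbitRel.Quotient SignGroup ThreeSphere

theorem projective_mk_eq {x y : ThreeSphere}
    (h : (Quotient.mk _ x : RealProjectiveThreeSpace) = Quotient.mk _ y) : x = y ∨ x = -y := by
  obtain ⟨g, hg⟩ := Quotient.exact h
  rcases signGroup_eq g with h | h
  · left
    rw [← hg]
    apply Subtype.ext
    change (g : ℝ) • (y : EuclideanSpace ℝ (Fin 4)) = y
    rw [h, one_smul]
  · right
    rw [← hg]
    apply Subtype.ext
    change (g : ℝ) • (y : EuclideanSpace ℝ (Fin 4)) = -y
    rw [h, neg_one_smul]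

theorem projective_mk_neg (x : ThreeSphere) :
    (Quotient.mk _ (-x) : RealProjectiveThreeSpace) = Quotient.mk _ x := by
  refine Quotient.sound ⟨-1, Subtype.ext ?_⟩
  change (-1 : ℝ) • (x : EuclideanSpace ℝ (Fin 4)) = -x
  rw [neg_one_smul]

/-- The transition maps between the charts of `ℝP³` are smooth. -/
theorem projective_transition_contDiffOn
    (hloc : IsLocalHomeomorph (Quotient.mk _ : ThreeSphere → RealProjectiveThreeSpace))
    (a b : ThreeSphere) :
    ContDiffOn ℝ ∞
      (((hloc.localInverseAt a).trans (chartAt (EuclideanSpace ℝ (Fin 3)) a)).symm.trans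
        ((hloc.localInverseAt b).trans (chartAt (EuclideanSpace ℝ (Fin 3)) b)))
      (((hloc.localInverseAt a).trans (chartAt (EuclideanSpace ℝ (Fin 3)) a)).symm.trans
        ((hloc.localInverseAt b).trans (chartAt (EuclideanSpace ℝ (Fin 3)) b))).source := by
  rw [← contMDiffOn_iff_contDiffOn]
  intro z hz
  simp only [OpenPartialHomeomorph.trans_source, OpenPartialHomeomorph.symm_source,
    OpenPartialHomeomorph.trans_symm_eq_symm_trans_symm,
    OpenPartialHomeomorph.coe_trans, Set.mem_inter_iff, Set.mem_preimage, Function.comp_apply,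
    IsLocalHomeomorph.localInverseAt_symm] at hz
  obtain ⟨⟨hz1, -⟩, hz3, hz4⟩ := hz
  set c := chartAt (EuclideanSpace ℝ (Fin 3)) a with hc
  set c' := chartAt (EuclideanSpace ℝ (Fin 3)) b with hc'
  set l' := hloc.localInverseAt b with hl'
  have hl : ∀ y ∈ l'.target, l' (Quotient.mk _ y) = y := by
    intro y hy
    have := l'.right_inv hy
    rwa [hl', IsLocalHomeomorph.localInverseAt_symm] at this
  have hyt : l' (Quotient.mk _ (c.symm z)) ∈ l'.target := l'.map_source hz3
  have hcs : ContMDiffAt 𝓘(ℝ, EuclideanSpace ℝ (Fin 3)) (𝓡 3) ∞ c.symm z :=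
    (contMDiffOn_chart_symm (I := 𝓡 3)).contMDiffAt (c.open_target.mem_nhds hz1)
  have hc's : ∀ y ∈ c'.source, ContMDiffAt (𝓡 3) 𝓘(ℝ, EuclideanSpace ℝ (Fin 3)) ∞ c' y :=
    fun y hy => (contMDiffOn_chart (I := 𝓡 3)).contMDiffAt (c'.open_source.mem_nhds hy)
  have hmk : (Quotient.mk _ (l' (Quotient.mk _ (c.symm z))) : RealProjectiveThreeSpace)
      = Quotient.mk _ (c.symm z) := hloc.apply_localInverseAt_of_mem hz3
  refine ContMDiffAt.contMDiffWithinAt ?_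
  simp only [OpenPartialHomeomorph.trans_symm_eq_symm_trans_symm,
    OpenPartialHomeomorph.coe_trans, IsLocalHomeomorph.localInverseAt_symm]
  rcases projective_mk_eq hmk with h | h
  · rw [h] at hyt hz4
    refine ((hc's _ hz4).comp z hcs).congr_of_eventuallyEq ?_
    filter_upwards [hcs.continuousAt.preimage_mem_nhds (l'.open_target.mem_nhds hyt)] with w hw
    exact congrArg c' (hl _ hw)
  · rw [h] at hyt hz4
    have : Fact (Module.finrank ℝ (EuclideanSpace ℝ (Fin 4)) = 3 + 1) := ⟨by simp⟩
    have hn : ContMDiffAt 𝓘(ℝ, EuclideanSpace ℝ (Fin 3)) (𝓡 3) ∞ (fun w => -c.symm w) z :=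
      ((contMDiff_neg_sphere (n := 3) (E := EuclideanSpace ℝ (Fin 4))).contMDiffAt).comp z hcs
    refine ((hc's _ hz4).comp z hn).congr_of_eventuallyEq ?_
    filter_upwards [hn.continuousAt.preimage_mem_nhds (l'.open_target.mem_nhds hyt)] with w hw
    have := hl _ hw
    rw [projective_mk_neg] at this
    exact congrArg c' this

instance : IsManifold (𝓡 3) ∞ RealProjectiveThreeSpace := by
  refine isManifold_of_contDiffOn (𝓡 3) ∞ _ ?_
  rintro _ _ ⟨p, rfl⟩ ⟨q, rfl⟩
  simpa using projective_transition_contDiffOn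
    isQuotientCoveringMap_quotientMk_of_properlyDiscontinuousSMul.isCoveringMap.isLocalHomeomorph _ _

/-! The Euler problem of two fixed centers in the plane. -/

/-- The Euclidean plane. -/
abbrev Plane : Type := EuclideanSpace ℝ (Fin 2)

/-- Pairs `(q, p)`, a position and a momentum. -/
abbrev Phase : Type := Plane × Plane

/-- The Euclidean space `ℝ³`, with coordinates `0, 1, 2`. -/
abbrev Space : Type := EuclideanSpace ℝ (Fin 3)

/-- The position of the Earth. -/
noncomputable def earth : Plane := !₂[-1 / 2, 0]

/-- The position of the Moon. -/
noncomputable def moon : Plane := !₂[1 / 2, 0]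

/-- The Hamiltonian `H(q, p)`. It is meaningful for `q ≠ E` and `q ≠ M`. -/
noncomputable def energy (μ : ℝ) (z : Phase) : ℝ :=
  ‖z.2‖ ^ 2 / 2 - (1 - μ) / ‖z.1 - earth‖ - μ / ‖z.1 - moon‖

/-- The critical Jacobi energy, the value of `H` at its only critical point. -/
noncomputable def jacobiEnergy (μ : ℝ) : ℝ := -1 - 2 * √(μ * (1 - μ))

/-- The energy hypersurface `H⁻¹(c)`. -/
def energyHypersurface (μ c : ℝ) : Set Phase :=
  {z | z.1 ≠ earth ∧ z.1 ≠ moon ∧ energy μ z = c}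

/-- The set of connected components of a subset of a topological space. -/
def componentsOf {X : Type*} [TopologicalSpace X] (S : Set X) : Set (Set X) :=
  {C | ∃ x ∈ S, C = connectedComponentIn S x}

/-! Symplectic notions. -/

/-- The form `∑ dp_j ∧ dq_j` on pairs `(q, p)`, evaluated at the vectors `a` and `b`. -/
noncomputable def canonicalForm {E : Type*} [NormedAddCommGroup E] [InnerProductSpace ℝ E]
    (a b : E × E) : ℝ :=
  inner ℝ a.2 b.1 - inner ℝ a.1 b.2

/-- The Lie derivative, along the vector field `Y`, of the form `canonicalForm` at the point `z`,
evaluated at the vectors `a` and `b`: for a form `ω` with constant coefficients,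
`(L_Y ω)(a, b) = ω(DY a, b) + ω(a, DY b)`. -/
noncomputable def lieDerivative {E : Type*} [NormedAddCommGroup E] [InnerProductSpace ℝ E]
    (Y : E × E → E × E) (z a b : E × E) : ℝ :=
  canonicalForm (fderiv ℝ Y z a) b + canonicalForm a (fderiv ℝ Y z b)

/-- Let `N` be a submanifold of `E × E` with tangent spaces `T z`, on which `canonicalForm`
restricts to a form `ω`. The field `Y` restricts to a Liouville vector field of `(N, ω)`: it is
smooth, tangent to `N`, and `L_Y ω = ω` on `N`. -/
def IsLiouvilleField {E : Type*} [NormedAddCommGroup E] [InnerProductSpace ℝ E]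
    (N : Set (E × E)) (T : E × E → Set (E × E)) (Y : E × E → E × E) : Prop :=
  ContDiff ℝ ∞ Y ∧ ∀ z ∈ N, Y z ∈ T z ∧
    ∀ a ∈ T z, ∀ b ∈ T z, lieDerivative Y z a b = canonicalForm a b

/-- The vector field `(q - A) ∂_q`. -/
def centralField (A : Plane) (z : Phase) : Phase := (z.1 - A, 0)

/-- The cotangent bundle of `S²`, as the set of the `(ξ, η)` in `ℝ³ × ℝ³` with `|ξ| = 1` and
`ξ · η = 0`. Its symplectic form is the restriction of `∑ dη_j ∧ dξ_j`. -/
def cotangentSphere : Set (Space × Space) :=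
  {z | ‖z.1‖ = 1 ∧ inner ℝ z.1 z.2 = 0}

/-- The tangent space of `T*S²` at the point `z`. -/
def cotangentSphereTangent (z : Space × Space) : Set (Space × Space) :=
  {w | inner ℝ z.1 w.1 = 0 ∧ inner ℝ w.1 z.2 + inner ℝ z.1 w.2 = 0}

/-- The vector field `η ∂_η`. -/
def fiberField (z : Space × Space) : Space × Space := (0, z.2)

/-! Moser's regularization. -/

/-- The north pole of `S²`. The points of `T*S²` over it are the collisions. -/
noncomputable def northPole : Space := !₂[1, 0, 0]

/-- Moser's map at the center `A`. It sends `(q, p)` to the pair `(x, y) = (p, A - q)`, and then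
follows the cotangent lift of the inverse of the stereographic projection from the north pole:
`ξ_0 = (|x|² - 1) / (|x|² + 1)`, `ξ_k = 2 x_k / (|x|² + 1)`,
`η_0 = x · y`, `η_k = (|x|² + 1) y_k / 2 - (x · y) x_k`. -/
noncomputable def moserMap (A : Plane) (z : Phase) : Space × Space :=
  let x := z.2
  let y := A - z.1
  let s := ‖x‖ ^ 2
  let t : ℝ := inner ℝ x y
  (!₂[(s - 1) / (s + 1), 2 * x 0 / (s + 1), 2 * x 1 / (s + 1)],
    !₂[t, (s + 1) / 2 * y 0 - t * x 0, (s + 1) / 2 * y 1 - t * x 1])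

/-- The regularization at the center `A` of a subset `C` of the phase space: its closure in `T*S²`,
where it is placed by Moser's map. -/
noncomputable def regularization (A : Plane) (C : Set Phase) : Set (Space × Space) :=
  closure (moserMap A '' C)

/-- Moser's map at `A` regularizes the subset `C` of the energy hypersurface `H⁻¹(c)` to the subset
`regularization A C` of `T*S²`. -/
structure IsRegularized (μ c : ℝ) (A : Plane) (C : Set Phase) : Prop where
  /-- Moser's map is smooth. -/
  smooth : ContDiff ℝ ∞ (moserMap A)
  /-- Moser's map is injective. -/
  injective : Function.Injective (moserMap A)
  /-- Moser's map is onto the part of `T*S²` that does not lie over the north pole. -/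
  range_eq : Set.range (moserMap A) = {w ∈ cotangentSphere | w.1 ≠ northPole}
  /-- Moser's map is symplectic. -/
  symplectic : ∀ z a b, canonicalForm (fderiv ℝ (moserMap A) z a) (fderiv ℝ (moserMap A) z b) =
    canonicalForm a b
  /-- The regularized hypersurface is compact. -/
  compact : IsCompact (regularization A C)
  /-- The regularized hypersurface lies in `T*S²`. -/
  subset : regularization A C ⊆ cotangentSphere
  /-- Only collisions are added to `C`. -/
  image_eq : moserMap A '' C = {w ∈ regularization A C | w.1 ≠ northPole}
  /-- The regularized hypersurface is the regular zero level set of a smooth function `K` on an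
  open subset of `T*S²`, and `K = |q - A| (H - c)` outside the collisions. Hence the orbits of the
  Hamiltonian `H` in `C` are the orbits of `K` after the change of time `dt = |q - A| dτ`. -/
  hamiltonian : ∃ (U : Set (Space × Space)) (K : Space × Space → ℝ),
    IsOpen U ∧ ContDiffOn ℝ ∞ K U ∧
    regularization A C = {w ∈ cotangentSphere ∩ U | K w = 0} ∧
    (∀ w ∈ regularization A C, ∃ v ∈ cotangentSphereTangent w, fderiv ℝ K w v ≠ 0) ∧
    ∀ z : Phase, z.1 ≠ earth → z.1 ≠ moon → moserMap A z ∈ U →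
      K (moserMap A z) = ‖z.1 - A‖ * (energy μ z - c)

/-! Hypersurfaces of `T*S²`. -/

/-- The tangent space at `z` of a subset `S` of `ℝ³ × ℝ³` with a three-dimensional smooth
structure, as a set of vectors of `ℝ³ × ℝ³`. -/
noncomputable def tangentVectors (S : Set (Space × Space))
    [ChartedSpace (EuclideanSpace ℝ (Fin 3)) S] (z : S) : Set (Space × Space) :=
  Set.range (fun v : TangentSpace (𝓡 3) z =>
    (mfderiv (𝓡 3) 𝓘(ℝ, Space × Space) (Subtype.val : S → Space × Space) z v : Space × Space))

/-- The smooth structure on `S` is that of a submanifold of `ℝ³ × ℝ³`: the inclusion, which is a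
topological embedding, is a smooth immersion. -/
def IsEmbeddedSubmanifold (S : Set (Space × Space))
    [ChartedSpace (EuclideanSpace ℝ (Fin 3)) S] : Prop :=
  IsManifold (𝓡 3) ∞ S ∧
    ContMDiff (𝓡 3) 𝓘(ℝ, Space × Space) ∞ (Subtype.val : S → Space × Space) ∧
    ∀ z : S, Function.Injective
      (mfderiv (𝓡 3) 𝓘(ℝ, Space × Space) (Subtype.val : S → Space × Space) z)

/-- The hypersurface `S` of `T*S²` is of restricted contact type, with the transverse Liouville
vector field `Y`. -/
def IsRestrictedContactTypeWith (S : Set (Space × Space))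
    [ChartedSpace (EuclideanSpace ℝ (Fin 3)) S] (Y : Space × Space → Space × Space) : Prop :=
  S ⊆ cotangentSphere ∧ IsLiouvilleField cotangentSphere cotangentSphereTangent Y ∧
    ∀ z : S, Y z ∉ tangentVectors S z

/-- The subset `S` of `T*S²` does not meet the zero section, and it meets every open ray that starts
at the origin of a fiber of `T*S²` in exactly one point. -/
def IsFiberwiseStarShaped (S : Set (Space × Space)) : Prop :=
  S ⊆ cotangentSphere ∧ (∀ z ∈ S, z.2 ≠ 0) ∧
    ∀ ξ η : Space, (ξ, η) ∈ cotangentSphere → η ≠ 0 → ∃! t : ℝ, 0 < t ∧ (ξ, t • η) ∈ S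

/-- The assertion about the component `C` of `H⁻¹(c)` around the center `A`. -/
structure IsContactProjectiveSpace (μ c : ℝ) (A : Plane) (C : Set Phase) : Prop where
  /-- The component `C` is regularized by Moser's map at `A`. -/
  regularized : IsRegularized μ c A C
  /-- The field `(q - A) ∂_q` is a Liouville field on the phase space. -/
  liouville : IsLiouvilleField {z : Phase | z.1 ≠ earth ∧ z.1 ≠ moon} (fun _ => Set.univ)
    (centralField A)
  /-- The field `(q - A) ∂_q` is transverse to `C`. -/
  transverse : ∀ z ∈ C, fderiv ℝ (energy μ) z (centralField A z) ≠ 0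
  /-- The field `η ∂_η` extends the field `(q - A) ∂_q` to `T*S²`. -/
  extends_field : ∀ z, fderiv ℝ (moserMap A) z (centralField A z) = fiberField (moserMap A z)
  /-- The regularized component is fiberwise star-shaped. -/
  starShaped : IsFiberwiseStarShaped (regularization A C)
  /-- The regularized component is a submanifold of `T*S²` which is diffeomorphic to `ℝP³` and of
  restricted contact type, with the transverse Liouville field that extends `(q - A) ∂_q`. -/
  contact : ∃ _ : ChartedSpace (EuclideanSpace ℝ (Fin 3)) (regularization A C),
    IsEmbeddedSubmanifold (regularization A C) ∧
    Nonempty (Diffeomorph (𝓡 3) (𝓡 3) (regularization A C) RealProjectiveThreeSpace ∞) ∧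
    IsRestrictedContactTypeWith (regularization A C) fiberField

end EulerProblem

/-!
The two centers are treated alike: `TwoCenters` records a center `A` of mass `a`, the other center
`B` of mass `b`, with `|A - B| = 1`, and an energy `c < -(√a + √b)²`, which is `c_J` for `a + b = 1`.
On the segment from `A` to `B` the critical point of the potential has the distance
`R = √a / (√a + √b)` from `A` (`radius`). Let `U(q) = -a / |q - A| - b / |q - B|`.

*Separation.* A position with `|q - A| ≥ R` and `|q - B| ≥ 1 - R` has `U(q) ≥ -(√a + √b)² > c`, so
the energy hypersurface lies over the two open balls `|q - A| < R` and `|q - B| < 1 - R`, which are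
disjoint.

*Regularization.* Under Moser's map `|q - A| = (1 - ξ₀) |η|` and `|p|² = (1 + ξ₀) / (1 - ξ₀)`, so
`K = |q - A| (H - c)` becomes
`|η| ((1 + ξ₀) / 2 - (1 - ξ₀) (c + b / |A - B - y|)) - a`, where the displacement `y = A - q` is
polynomial in `(ξ, η)`. This formula is smooth over the north pole too.

*Star-shapedness.* Along a ray of a fiber `K` is `-a` at the zero section and positive when
`|q - A|` reaches `R`, so it has a zero (`exists_smul_mem_hypersurface`). If `r = |q - A| < R`, then
`b / (1 - r)² < a / r²`: the attraction of `A` exceeds that of `B`. Hence the zero is unique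
(`smul_mem_hypersurface_unique`) and the derivative of `K` along `η ∂_η` is positive on the zero set
(`fderiv_regularized_fiberField_pos`). This gives the regularity of `K` and both transversality
statements.

*Topology.* In complex notation, `(z, w) ↦ (|z|² - |w|², 2 z w; 2 Re(z̄ w), w² - z²)` maps the
three-sphere onto the unit cotangent bundle of `S²`. It identifies exactly the antipodal points, and
it is an immersion. Multiplying the covector by the length at which its ray meets the zero set of
`K` gives a smooth map (implicit function theorem) onto the regularized hypersurface, which is
therefore a compact embedded `ℝP³` (`exists_isEmbeddedSubmanifold_projective`). The collisions
correspond to the circle `w = 0`. The complement of this circle is connected and dense in the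
three-sphere; hence the part of the energy hypersurface over `|q - A| < R` is connected, and the
closure of its image under Moser's map is the whole regularized hypersurface.
-/

namespace EulerProblem

/-! ### Smooth structures on embedded copies of manifolds -/

section Transport

variable {M S : Type*} [TopologicalSpace M] [TopologicalSpace S]
  [ChartedSpace (EuclideanSpace ℝ (Fin 3)) M]

/-- The charts of `M`, carried to `S` by a homeomorphism. -/
@[reducible]
def transportedChartedSpace (e : M ≃ₜ S) : ChartedSpace (EuclideanSpace ℝ (Fin 3)) S where
  atlas := {ψ | ∃ φ ∈ atlas (EuclideanSpace ℝ (Fin 3)) M,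
    ψ = e.symm.toOpenPartialHomeomorph.trans φ}
  chartAt z := e.symm.toOpenPartialHomeomorph.trans (chartAt _ (e.symm z))
  mem_chart_source z := by simp
  chart_mem_atlas z := ⟨_, chart_mem_atlas _ _, rfl⟩

theorem isManifold_transported [IsManifold (𝓡 3) ∞ M] (e : M ≃ₜ S) :
    @IsManifold ℝ _ _ _ _ _ _ (𝓡 3) ∞ S _ (transportedChartedSpace e) := by
  let _ := transportedChartedSpace e
  refine isManifold_of_contDiffOn (𝓡 3) ∞ _ ?_
  rintro _ _ ⟨φ, hφ, rfl⟩ ⟨φ', hφ', rfl⟩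
  have h := (contDiffGroupoid ∞ (𝓡 3)).compatible hφ hφ'
  rw [contDiffGroupoid, mem_groupoid_of_pregroupoid] at h
  have h1 := h.1
  simp only [contDiffPregroupoid] at h1
  refine (h1.congr_mono ?_ ?_)
  · intro x hx
    simp
  · intro x hx
    simpa using hx

/-- A homeomorphism that carries the charts is a diffeomorphism. -/
theorem exists_diffeomorph_transported [IsManifold (𝓡 3) ∞ M] (e : M ≃ₜ S) :
    ∃ _ : ChartedSpace (EuclideanSpace ℝ (Fin 3)) S, IsManifold (𝓡 3) ∞ S ∧
      ∃ D : Diffeomorph (𝓡 3) (𝓡 3) S M ∞, ∀ z, D z = e.symm z := by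
  let _ := transportedChartedSpace e
  have := isManifold_transported e
  refine ⟨transportedChartedSpace e, isManifold_transported e,
    ⟨e.symm.toEquiv, ?_, ?_⟩, fun z => rfl⟩
  · intro z
    have h1 : ContMDiffAt (𝓡 3) 𝓘(ℝ, EuclideanSpace ℝ (Fin 3)) ∞
        (chartAt (EuclideanSpace ℝ (Fin 3)) z) z :=
      (contMDiffOn_chart (I := 𝓡 3)).contMDiffAt ((chartAt _ z).open_source.mem_nhds
        (mem_chart_source _ z))
    have h2 : ContMDiffAt 𝓘(ℝ, EuclideanSpace ℝ (Fin 3)) (𝓡 3) ∞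
        (chartAt (EuclideanSpace ℝ (Fin 3)) (e.symm z)).symm (chartAt _ z z) :=
      (contMDiffOn_chart_symm (I := 𝓡 3)).contMDiffAt ((chartAt _ (e.symm z)).open_target.mem_nhds
        (mem_chart_target _ (e.symm z)))
    refine (h2.comp z h1).congr_of_eventuallyEq ?_
    filter_upwards [(chartAt (EuclideanSpace ℝ (Fin 3)) z).open_source.mem_nhds
        (mem_chart_source _ z)] with w hw
    change w ∈ (e.symm.toOpenPartialHomeomorph.trans (chartAt _ (e.symm z))).source at hw
    exact ((chartAt _ (e.symm z)).left_inv (by simpa using hw)).symm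
  · intro x
    have h1 : ContMDiffAt (𝓡 3) 𝓘(ℝ, EuclideanSpace ℝ (Fin 3)) ∞
        (chartAt (EuclideanSpace ℝ (Fin 3)) x) x :=
      (contMDiffOn_chart (I := 𝓡 3)).contMDiffAt ((chartAt _ x).open_source.mem_nhds
        (mem_chart_source _ x))
    have hx : chartAt (EuclideanSpace ℝ (Fin 3)) (e x)
        = e.symm.toOpenPartialHomeomorph.trans (chartAt _ x) := by
      change e.symm.toOpenPartialHomeomorph.trans (chartAt _ (e.symm (e x))) = _
      rw [e.symm_apply_apply]
    have h2 : ContMDiffAt 𝓘(ℝ, EuclideanSpace ℝ (Fin 3)) (𝓡 3) ∞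
        (chartAt (EuclideanSpace ℝ (Fin 3)) (e x)).symm (chartAt _ x x) :=
      (contMDiffOn_chart_symm (I := 𝓡 3)).contMDiffAt ((chartAt _ (e x)).open_target.mem_nhds
        (by rw [hx]; simp))
    refine (h2.comp x h1).congr_of_eventuallyEq ?_
    filter_upwards [(chartAt (EuclideanSpace ℝ (Fin 3)) x).open_source.mem_nhds
        (mem_chart_source _ x)] with w hw
    simp [hx, (chartAt (EuclideanSpace ℝ (Fin 3)) x).left_inv hw]

end Transport

/-- The image of a compact three-dimensional manifold under an injective immersion into `ℝ³ × ℝ³`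
is an embedded submanifold, and it is diffeomorphic to the manifold. -/
theorem exists_isEmbeddedSubmanifold_range {M : Type*} [TopologicalSpace M] [CompactSpace M]
    [ChartedSpace (EuclideanSpace ℝ (Fin 3)) M] [IsManifold (𝓡 3) ∞ M] {f : M → Space × Space}
    (hf : ContMDiff (𝓡 3) 𝓘(ℝ, Space × Space) ∞ f) (hinj : Function.Injective f)
    (himm : ∀ x, Function.Injective (mfderiv (𝓡 3) 𝓘(ℝ, Space × Space) f x)) :
    ∃ _ : ChartedSpace (EuclideanSpace ℝ (Fin 3)) (Set.range f),
      IsEmbeddedSubmanifold (Set.range f) ∧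
      Nonempty (Diffeomorph (𝓡 3) (𝓡 3) (Set.range f) M ∞) := by
  have hemb : Topology.IsEmbedding f := (hf.continuous.isClosedEmbedding hinj).isEmbedding
  obtain ⟨hS, hman, D, hD⟩ := exists_diffeomorph_transported hemb.toHomeomorph
  have hval : (Subtype.val : Set.range f → Space × Space) = f ∘ D := by
    funext z
    simp only [Function.comp_apply, hD]
    conv_lhs => rw [← hemb.toHomeomorph.apply_symm_apply z]
    rfl
  refine ⟨hS, ⟨hman, hval ▸ hf.comp D.contMDiff, fun z => ?_⟩, ⟨D⟩⟩
  rw [hval, mfderiv_comp z ((hf _).mdifferentiableAt (by simp))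
    ((D.contMDiff z).mdifferentiableAt (by simp))]
  refine (himm _).comp ?_
  exact (D.mfderivToContinuousLinearEquiv (by simp) z).injective

/-! ### Maps on the real projective space -/

/-- Every chart of `ℝP³` factors through a local section of the quotient map, and this section is
an immersion. -/
theorem exists_local_section (y : RealProjectiveThreeSpace) :
    ∃ s : RealProjectiveThreeSpace → ThreeSphere,
      ContMDiffAt (𝓡 3) (𝓡 3) ∞ s y ∧
      (∀ᶠ w in 𝓝 y, (Quotient.mk _ (s w) : RealProjectiveThreeSpace) = w) ∧
      Function.Injective (mfderiv (𝓡 3) (𝓡 3) s y) := by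
  have hloc : IsLocalHomeomorph (Quotient.mk _ : ThreeSphere → RealProjectiveThreeSpace) :=
    isQuotientCoveringMap_quotientMk_of_properlyDiscontinuousSMul.isCoveringMap.isLocalHomeomorph
  obtain ⟨a, ha, hchart⟩ : ∃ a : ThreeSphere, Quotient.mk _ a = y ∧
      chartAt (EuclideanSpace ℝ (Fin 3)) y
        = (hloc.localInverseAt a).trans (chartAt (EuclideanSpace ℝ (Fin 3)) a) :=
    ⟨_, (Quotient.mk_surjective.hasRightInverse).choose_spec y, rfl⟩
  set s := hloc.localInverseAt a with hs
  have hsy : s y = a := by rw [← ha]; exact hloc.localInverseAt_apply_self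
  have hsrc : y ∈ s.source := by rw [← ha]; exact hloc.apply_self_mem_localInverseAt_source
  have hφ : ContMDiffAt (𝓡 3) 𝓘(ℝ, EuclideanSpace ℝ (Fin 3)) ∞
      (chartAt (EuclideanSpace ℝ (Fin 3)) y) y :=
    (contMDiffOn_chart (I := 𝓡 3)).contMDiffAt ((chartAt _ y).open_source.mem_nhds
      (mem_chart_source _ y))
  have hc : ContMDiffAt 𝓘(ℝ, EuclideanSpace ℝ (Fin 3)) (𝓡 3) ∞
      (chartAt (EuclideanSpace ℝ (Fin 3)) a).symm (chartAt _ y y) := by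
    refine (contMDiffOn_chart_symm (I := 𝓡 3)).contMDiffAt
      ((chartAt _ a).open_target.mem_nhds ?_)
    rw [hchart, OpenPartialHomeomorph.coe_trans, Function.comp_apply, hsy]
    exact mem_chart_target _ a
  have hsmooth : ContMDiffAt (𝓡 3) (𝓡 3) ∞ s y := by
    refine (hc.comp y hφ).congr_of_eventuallyEq ?_
    filter_upwards [(chartAt (EuclideanSpace ℝ (Fin 3)) y).open_source.mem_nhds
        (mem_chart_source _ y)] with w hw
    rw [hchart] at hw
    simp only [OpenPartialHomeomorph.trans_source, Set.mem_inter_iff, Set.mem_preimage] at hw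
    rw [hchart, Function.comp_apply, OpenPartialHomeomorph.coe_trans, Function.comp_apply,
      (chartAt _ a).left_inv hw.2]
  refine ⟨s, hsmooth, ?_, ?_⟩
  · filter_upwards [s.open_source.mem_nhds hsrc] with w hw
    exact hloc.apply_localInverseAt_of_mem hw
  · have h1 := (isInvertible_mfderiv_extChartAt (I := 𝓡 3) (mem_extChartAt_source (I := 𝓡 3) y))
    have h2 : (extChartAt (𝓡 3) y : RealProjectiveThreeSpace → EuclideanSpace ℝ (Fin 3))
        = extChartAt (𝓡 3) a ∘ s := by
      rw [extChartAt_coe, hchart, extChartAt_coe]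
      rfl
    rw [h2, mfderiv_comp y (by rw [hsy]; exact mdifferentiableAt_extChartAt (mem_chart_source _ a))
      (hsmooth.mdifferentiableAt (by simp))] at h1
    have h3 := h1.injective
    exact Function.Injective.of_comp h3

/-- An immersion of the three-sphere that identifies exactly the antipodal points embeds `ℝP³`. -/
theorem exists_isEmbeddedSubmanifold_projective {f : ThreeSphere → Space × Space}
    (hf : ContMDiff (𝓡 3) 𝓘(ℝ, Space × Space) ∞ f)
    (hinj : ∀ x y, f x = f y ↔ x = y ∨ x = -y)
    (himm : ∀ x, Function.Injective (mfderiv (𝓡 3) 𝓘(ℝ, Space × Space) f x)) :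
    ∃ _ : ChartedSpace (EuclideanSpace ℝ (Fin 3)) (Set.range f),
      IsEmbeddedSubmanifold (Set.range f) ∧
      Nonempty (Diffeomorph (𝓡 3) (𝓡 3) (Set.range f) RealProjectiveThreeSpace ∞) := by
  let g : RealProjectiveThreeSpace → Space × Space := Quotient.lift f (by
    intro x y h
    exact (hinj x y).2 (projective_mk_eq (Quotient.sound h)))
  have hg : ∀ x, g (Quotient.mk _ x) = f x := fun x => rfl
  have hrange : Set.range g = Set.range f := by
    ext w
    constructor
    · rintro ⟨y, rfl⟩
      obtain ⟨x, rfl⟩ := Quotient.mk_surjective y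
      exact ⟨x, rfl⟩
    · rintro ⟨x, rfl⟩
      exact ⟨Quotient.mk _ x, rfl⟩
  have hlocal : ∀ y, ContMDiffAt (𝓡 3) 𝓘(ℝ, Space × Space) ∞ g y ∧
      Function.Injective (mfderiv (𝓡 3) 𝓘(ℝ, Space × Space) g y) := by
    intro y
    obtain ⟨s, hs, hmk, hsi⟩ := exists_local_section y
    have hev : g =ᶠ[𝓝 y] f ∘ s := by
      filter_upwards [hmk] with w hw
      rw [Function.comp_apply, ← hg, hw]
    refine ⟨((hf _).comp y hs).congr_of_eventuallyEq hev, ?_⟩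
    rw [hev.mfderiv_eq, mfderiv_comp y ((hf _).mdifferentiableAt (by simp))
      (hs.mdifferentiableAt (by simp))]
    exact (himm _).comp hsi
  have hginj : Function.Injective g := by
    intro y y' h
    obtain ⟨x, rfl⟩ := Quotient.mk_surjective y
    obtain ⟨x', rfl⟩ := Quotient.mk_surjective y'
    rcases (hinj x x').1 h with h | h
    · rw [h]
    · rw [h, projective_mk_neg]
  have : CompactSpace RealProjectiveThreeSpace := Quotient.compactSpace
  have := exists_isEmbeddedSubmanifold_range (fun y => (hlocal y).1) hginj
    (fun y => (hlocal y).2)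
  rwa [hrange] at this

/-- The differential of a function that vanishes on a submanifold vanishes on its tangent
vectors. -/
theorem fderiv_eq_zero_of_mem_tangentVectors {S : Set (Space × Space)}
    [ChartedSpace (EuclideanSpace ℝ (Fin 3)) S] (hS : IsEmbeddedSubmanifold S)
    {K : Space × Space → ℝ} (hK : ∀ w ∈ S, K w = 0) (z : S) (hd : DifferentiableAt ℝ K z)
    {v : Space × Space} (hv : v ∈ tangentVectors S z) : fderiv ℝ K z v = 0 := by
  obtain ⟨u, rfl⟩ := hv
  have h0 : K ∘ (Subtype.val : S → Space × Space) = fun _ => (0 : ℝ) :=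
    funext fun w => hK w w.2
  have h1 := mfderiv_comp (I := 𝓡 3) (I' := 𝓘(ℝ, Space × Space)) (I'' := 𝓘(ℝ, ℝ)) z
    hd.mdifferentiableAt ((hS.2.1 z).mdifferentiableAt (by simp))
  rw [h0, mfderiv_const, mfderiv_eq_fderiv] at h1
  exact (DFunLike.congr_fun h1 u).symm

/-! ### Moser's map -/

theorem plane_norm_sq (x : Plane) : ‖x‖ ^ 2 = x 0 ^ 2 + x 1 ^ 2 := by
  simp [EuclideanSpace.real_norm_sq_eq]

theorem space_norm_sq (x : Space) : ‖x‖ ^ 2 = x 0 ^ 2 + x 1 ^ 2 + x 2 ^ 2 := by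
  simp [EuclideanSpace.real_norm_sq_eq, Fin.sum_univ_three]

theorem plane_inner (x y : Plane) : inner ℝ x y = x 0 * y 0 + x 1 * y 1 := by
  simp [PiLp.inner_apply, mul_comm]

theorem space_inner (x y : Space) : inner ℝ x y = x 0 * y 0 + x 1 * y 1 + x 2 * y 2 := by
  simp [PiLp.inner_apply, Fin.sum_univ_three, mul_comm]

theorem plane_ext {x y : Plane} (h0 : x 0 = y 0) (h1 : x 1 = y 1) : x = y := by
  ext i; fin_cases i <;> assumption

theorem space_ext {x y : Space} (h0 : x 0 = y 0) (h1 : x 1 = y 1) (h2 : x 2 = y 2) : x = y := by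
  ext i; fin_cases i <;> assumption

theorem mem_cotangentSphere_iff {w : Space × Space} : w ∈ cotangentSphere ↔
    w.1 0 ^ 2 + w.1 1 ^ 2 + w.1 2 ^ 2 = 1 ∧ w.1 0 * w.2 0 + w.1 1 * w.2 1 + w.1 2 * w.2 2 = 0 := by
  rw [cotangentSphere, Set.mem_ofPred_eq, space_inner, ← space_norm_sq]
  exact and_congr_left fun _ => (pow_eq_one_iff_of_nonneg (norm_nonneg _) two_ne_zero).symm

/-- The vector `y = A - q`, in terms of the point `(ξ, η)` of `T*S²`: it inverts the fiberwise
linear part of Moser's map, and it is polynomial in `(ξ, η)`, also over the north pole. -/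
noncomputable def displacement (w : Space × Space) : Plane :=
  !₂[(1 - w.1 0) * w.2 1 + w.1 1 * w.2 0, (1 - w.1 0) * w.2 2 + w.1 2 * w.2 0]

@[simp] theorem displacement_zero (w : Space × Space) :
    displacement w 0 = (1 - w.1 0) * w.2 1 + w.1 1 * w.2 0 := rfl

@[simp] theorem displacement_one (w : Space × Space) :
    displacement w 1 = (1 - w.1 0) * w.2 2 + w.1 2 * w.2 0 := rfl

theorem contDiff_displacement : ContDiff ℝ ∞ displacement := by
  rw [contDiff_euclidean]
  intro i
  fin_cases i
  · simp only [Fin.zero_eta, displacement_zero]; fun_prop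
  · simp only [Fin.mk_one, displacement_one]; fun_prop

theorem displacement_smul (ξ η : Space) (t : ℝ) :
    displacement (ξ, t • η) = t • displacement (ξ, η) := by
  apply plane_ext <;> simp <;> ring

/-- The inverse of Moser's map, away from the north pole. -/
noncomputable def moserInverse (A : Plane) (w : Space × Space) : Phase :=
  (A - displacement w, !₂[w.1 1 / (1 - w.1 0), w.1 2 / (1 - w.1 0)])

section Coordinates

variable (A : Plane) (z : Phase)

theorem moserMap_fst_zero :
    (moserMap A z).1 0 = (z.2 0 ^ 2 + z.2 1 ^ 2 - 1) / (z.2 0 ^ 2 + z.2 1 ^ 2 + 1) := by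
  rw [← plane_norm_sq]; rfl

theorem moserMap_fst_one : (moserMap A z).1 1 = 2 * z.2 0 / (z.2 0 ^ 2 + z.2 1 ^ 2 + 1) := by
  rw [← plane_norm_sq]; rfl

theorem moserMap_fst_two : (moserMap A z).1 2 = 2 * z.2 1 / (z.2 0 ^ 2 + z.2 1 ^ 2 + 1) := by
  rw [← plane_norm_sq]; rfl

theorem moserMap_snd_zero :
    (moserMap A z).2 0 = z.2 0 * (A 0 - z.1 0) + z.2 1 * (A 1 - z.1 1) := by
  change inner ℝ z.2 (A - z.1) = _
  simp [plane_inner]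

theorem moserMap_snd_one : (moserMap A z).2 1 = (z.2 0 ^ 2 + z.2 1 ^ 2 + 1) / 2 * (A 0 - z.1 0) -
    (z.2 0 * (A 0 - z.1 0) + z.2 1 * (A 1 - z.1 1)) * z.2 0 := by
  rw [← moserMap_snd_zero, ← plane_norm_sq]; rfl

theorem moserMap_snd_two : (moserMap A z).2 2 = (z.2 0 ^ 2 + z.2 1 ^ 2 + 1) / 2 * (A 1 - z.1 1) -
    (z.2 0 * (A 0 - z.1 0) + z.2 1 * (A 1 - z.1 1)) * z.2 1 := by
  rw [← moserMap_snd_zero, ← plane_norm_sq]; rfl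

end Coordinates

theorem contDiff_moserMap (A : Plane) : ContDiff ℝ ∞ (moserMap A) := by
  have hξ : ∀ i, ContDiff ℝ ∞ fun z => (moserMap A z).1 i := by
    intro i
    fin_cases i
    · change ContDiff ℝ ∞ fun z => (moserMap A z).1 0
      rw [funext (moserMap_fst_zero A)]
      fun_prop (disch := intros; positivity)
    · change ContDiff ℝ ∞ fun z => (moserMap A z).1 1
      rw [funext (moserMap_fst_one A)]
      fun_prop (disch := intros; positivity)
    · change ContDiff ℝ ∞ fun z => (moserMap A z).1 2
      rw [funext (moserMap_fst_two A)]
      fun_prop (disch := intros; positivity)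
  have hη : ∀ i, ContDiff ℝ ∞ fun z => (moserMap A z).2 i := by
    intro i
    fin_cases i
    · change ContDiff ℝ ∞ fun z => (moserMap A z).2 0
      rw [funext (moserMap_snd_zero A)]
      fun_prop
    · change ContDiff ℝ ∞ fun z => (moserMap A z).2 1
      rw [funext (moserMap_snd_one A)]
      fun_prop
    · change ContDiff ℝ ∞ fun z => (moserMap A z).2 2
      rw [funext (moserMap_snd_two A)]
      fun_prop
  exact (contDiff_euclidean.2 hξ).prodMk (contDiff_euclidean.2 hη)

theorem moserMap_mem_cotangentSphere (A : Plane) (z : Phase) :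
    moserMap A z ∈ cotangentSphere := by
  rw [mem_cotangentSphere_iff, moserMap_fst_zero, moserMap_fst_one, moserMap_fst_two,
    moserMap_snd_zero, moserMap_snd_one, moserMap_snd_two]
  have h : z.2 0 ^ 2 + z.2 1 ^ 2 + 1 ≠ 0 := by positivity
  constructor <;> field_simp <;> ring

theorem one_sub_moserMap_fst_zero (A : Plane) (z : Phase) :
    1 - (moserMap A z).1 0 = 2 / (z.2 0 ^ 2 + z.2 1 ^ 2 + 1) := by
  rw [moserMap_fst_zero]
  have h : z.2 0 ^ 2 + z.2 1 ^ 2 + 1 ≠ 0 := by positivity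
  field_simp
  ring

theorem ne_northPole_iff {w : Space × Space} (hw : w ∈ cotangentSphere) :
    w.1 ≠ northPole ↔ 0 < 1 - w.1 0 := by
  rw [mem_cotangentSphere_iff] at hw
  constructor
  · intro h
    by_contra h0
    have h00 : w.1 0 = 1 := by nlinarith [sq_nonneg (w.1 1), sq_nonneg (w.1 2)]
    have h1 : w.1 1 = 0 := by nlinarith [sq_nonneg (w.1 1), sq_nonneg (w.1 2)]
    have h2 : w.1 2 = 0 := by nlinarith [sq_nonneg (w.1 1), sq_nonneg (w.1 2)]
    exact h (space_ext h00 h1 h2)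
  · intro h h'
    rw [h'] at h
    simp [northPole] at h

theorem moserMap_fst_ne_northPole (A : Plane) (z : Phase) : (moserMap A z).1 ≠ northPole := by
  rw [ne_northPole_iff (moserMap_mem_cotangentSphere A z), one_sub_moserMap_fst_zero]
  positivity

theorem displacement_moserMap (A : Plane) (z : Phase) :
    displacement (moserMap A z) = A - z.1 := by
  have h : z.2 0 ^ 2 + z.2 1 ^ 2 + 1 ≠ 0 := by positivity
  apply plane_ext
  · rw [displacement_zero, one_sub_moserMap_fst_zero, moserMap_fst_one, moserMap_snd_zero,
      moserMap_snd_one, PiLp.sub_apply]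
    field_simp
    ring
  · rw [displacement_one, one_sub_moserMap_fst_zero, moserMap_fst_two, moserMap_snd_zero,
      moserMap_snd_two, PiLp.sub_apply]
    field_simp
    ring

theorem moserInverse_moserMap (A : Plane) (z : Phase) : moserInverse A (moserMap A z) = z := by
  have h : z.2 0 ^ 2 + z.2 1 ^ 2 + 1 ≠ 0 := by positivity
  refine Prod.ext ?_ (plane_ext ?_ ?_)
  · simp [moserInverse, displacement_moserMap]
  · change (moserMap A z).1 1 / (1 - (moserMap A z).1 0) = _
    rw [one_sub_moserMap_fst_zero, moserMap_fst_one]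
    field_simp
  · change (moserMap A z).1 2 / (1 - (moserMap A z).1 0) = _
    rw [one_sub_moserMap_fst_zero, moserMap_fst_two]
    field_simp

/-- A vector `v ⊥ ξ` is determined by `ξ ≠ N` and by its displacement: the displacement `y`
satisfies `ξ' · y = (1 - ξ₀) v₀`, with `ξ' = (ξ₁, ξ₂)`. -/
theorem eq_of_displacement_eq {ξ v v' : Space} (h : (ξ, v) ∈ cotangentSphere)
    (h' : (ξ, v') ∈ cotangentSphere) (hN : 0 < 1 - ξ 0)
    (hd : displacement (ξ, v) = displacement (ξ, v')) : v = v' := by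
  rw [mem_cotangentSphere_iff] at h h'
  obtain ⟨hn, ho⟩ := h
  obtain ⟨-, ho'⟩ := h'
  have h1 : (1 - ξ 0) * v 1 + ξ 1 * v 0 = (1 - ξ 0) * v' 1 + ξ 1 * v' 0 := congrArg (fun y => y 0) hd
  have h2 : (1 - ξ 0) * v 2 + ξ 2 * v 0 = (1 - ξ 0) * v' 2 + ξ 2 * v' 0 := congrArg (fun y => y 1) hd
  simp only at hn ho ho'
  have h0 : v 0 = v' 0 := by
    refine mul_left_cancel₀ hN.ne' ?_
    linear_combination ξ 1 * h1 + ξ 2 * h2 - (1 - ξ 0) * (ho - ho') - (v 0 - v' 0) * hn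
  refine space_ext h0 ?_ ?_
  · refine mul_left_cancel₀ hN.ne' ?_
    linear_combination h1 - ξ 1 * h0
  · refine mul_left_cancel₀ hN.ne' ?_
    linear_combination h2 - ξ 2 * h0

theorem moserMap_moserInverse (A : Plane) {w : Space × Space} (hw : w ∈ cotangentSphere)
    (hN : w.1 ≠ northPole) : moserMap A (moserInverse A w) = w := by
  have hN' := (ne_northPole_iff hw).1 hN
  have hne := hN'.ne'
  have hw' := mem_cotangentSphere_iff.1 hw
  have hs : (moserInverse A w).2 0 ^ 2 + (moserInverse A w).2 1 ^ 2 + 1 = 2 / (1 - w.1 0) := by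
    change (w.1 1 / (1 - w.1 0)) ^ 2 + (w.1 2 / (1 - w.1 0)) ^ 2 + 1 = _
    field_simp
    linear_combination hw'.1
  have hξ : (moserMap A (moserInverse A w)).1 = w.1 := by
    apply space_ext
    · have := one_sub_moserMap_fst_zero A (moserInverse A w)
      rw [hs] at this
      field_simp at this
      linarith
    · rw [moserMap_fst_one, hs]
      change 2 * (w.1 1 / (1 - w.1 0)) / _ = _
      field_simp
    · rw [moserMap_fst_two, hs]
      change 2 * (w.1 2 / (1 - w.1 0)) / _ = _
      field_simp
  refine Prod.ext hξ (eq_of_displacement_eq (ξ := w.1) ?_ hw hN' ?_)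
  · rw [← hξ]
    exact moserMap_mem_cotangentSphere A (moserInverse A w)
  · have := displacement_moserMap A (moserInverse A w)
    rw [← Prod.mk.eta (p := moserMap A (moserInverse A w)), hξ] at this
    rw [this]
    simp [moserInverse]

theorem injective_moserMap (A : Plane) : Function.Injective (moserMap A) :=
  Function.LeftInverse.injective (moserInverse_moserMap A)

theorem range_moserMap (A : Plane) :
    Set.range (moserMap A) = {w ∈ cotangentSphere | w.1 ≠ northPole} := by
  ext w
  constructor
  · rintro ⟨z, rfl⟩
    exact ⟨moserMap_mem_cotangentSphere A z, moserMap_fst_ne_northPole A z⟩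
  · rintro ⟨hw, hN⟩
    exact ⟨_, moserMap_moserInverse A hw hN⟩

theorem continuousOn_moserInverse (A : Plane) :
    ContinuousOn (moserInverse A) {w | w.1 0 ≠ 1} := by
  refine ContinuousOn.prodMk ?_ ?_
  · exact (continuous_const.sub contDiff_displacement.continuous).continuousOn
  · refine (PiLp.continuous_toLp 2 _).comp_continuousOn ?_
    refine continuousOn_pi.2 fun i => ?_
    have hc : ∀ j : Fin 3, ContinuousOn (fun w : Space × Space => w.1 j / (1 - w.1 0))
        {w | w.1 0 ≠ 1} := fun j => by
      refine ContinuousOn.div (by fun_prop) (by fun_prop) fun w hw => ?_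
      exact sub_ne_zero.2 (Ne.symm hw)
    fin_cases i
    · exact hc 1
    · exact hc 2

/-! ### Moser's map is symplectic, and its Liouville fields -/

/-- The coordinates of `DΦ(z) a` are the derivatives of the coordinates of `Φ` along the line
`z + t a`. -/
theorem hasDerivAt_moserMap_line (A : Plane) (z a : Phase) (i : Fin 3) :
    HasDerivAt (fun t : ℝ => (moserMap A (z + t • a)).1 i)
      ((fderiv ℝ (moserMap A) z a).1 i) 0 ∧
    HasDerivAt (fun t : ℝ => (moserMap A (z + t • a)).2 i)
      ((fderiv ℝ (moserMap A) z a).2 i) 0 := by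
  have hline : HasDerivAt (fun t : ℝ => z + t • a) a 0 := by
    simpa using ((hasDerivAt_id (0 : ℝ)).smul_const a).const_add z
  have hm : HasDerivAt (fun t : ℝ => moserMap A (z + t • a)) (fderiv ℝ (moserMap A) z a) 0 := by
    have h1 : HasFDerivAt (moserMap A) (fderiv ℝ (moserMap A) z) (z + (0 : ℝ) • a) := by
      simpa using ((contDiff_moserMap A).differentiable (by simp) z).hasFDerivAt
    exact h1.comp_hasDerivAt 0 hline
  exact ⟨((EuclideanSpace.proj i : Space →L[ℝ] ℝ).comp
      (ContinuousLinearMap.fst ℝ Space Space)).hasFDerivAt.comp_hasDerivAt 0 hm,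
    ((EuclideanSpace.proj i : Space →L[ℝ] ℝ).comp
      (ContinuousLinearMap.snd ℝ Space Space)).hasFDerivAt.comp_hasDerivAt 0 hm⟩

/-- The differential of Moser's map, in coordinates: `x = p` and `y = A - q` vary by `u` and by
`-v`, where `a = (v, u)` is the tangent vector. -/
theorem fderiv_moserMap (A : Plane) (z a : Phase) (x0 x1 y0 y1 u0 u1 v0 v1 : ℝ)
    (hx0 : z.2 0 = x0) (hx1 : z.2 1 = x1) (hy0 : A 0 - z.1 0 = y0) (hy1 : A 1 - z.1 1 = y1)
    (hu0 : a.2 0 = u0) (hu1 : a.2 1 = u1) (hv0 : a.1 0 = v0) (hv1 : a.1 1 = v1) :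
    (fderiv ℝ (moserMap A) z a).1 0 = 4 * (x0 * u0 + x1 * u1) / (x0 ^ 2 + x1 ^ 2 + 1) ^ 2 ∧
    (fderiv ℝ (moserMap A) z a).1 1 = (2 * u0 * (x0 ^ 2 + x1 ^ 2 + 1) -
      4 * x0 * (x0 * u0 + x1 * u1)) / (x0 ^ 2 + x1 ^ 2 + 1) ^ 2 ∧
    (fderiv ℝ (moserMap A) z a).1 2 = (2 * u1 * (x0 ^ 2 + x1 ^ 2 + 1) -
      4 * x1 * (x0 * u0 + x1 * u1)) / (x0 ^ 2 + x1 ^ 2 + 1) ^ 2 ∧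
    (fderiv ℝ (moserMap A) z a).2 0 = u0 * y0 + u1 * y1 - x0 * v0 - x1 * v1 ∧
    (fderiv ℝ (moserMap A) z a).2 1 = (x0 * u0 + x1 * u1) * y0 - (x0 ^ 2 + x1 ^ 2 + 1) / 2 * v0 -
      (u0 * y0 + u1 * y1 - x0 * v0 - x1 * v1) * x0 - (x0 * y0 + x1 * y1) * u0 ∧
    (fderiv ℝ (moserMap A) z a).2 2 = (x0 * u0 + x1 * u1) * y1 - (x0 ^ 2 + x1 ^ 2 + 1) / 2 * v1 -
      (u0 * y0 + u1 * y1 - x0 * v0 - x1 * v1) * x1 - (x0 * y0 + x1 * y1) * u1 := by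
  have hX0 : HasDerivAt (fun t : ℝ => (z + t • a).2 0) u0 0 := by
    simpa [hx0, hu0] using ((hasDerivAt_id (0 : ℝ)).mul_const u0).const_add x0
  have hX1 : HasDerivAt (fun t : ℝ => (z + t • a).2 1) u1 0 := by
    simpa [hx1, hu1] using ((hasDerivAt_id (0 : ℝ)).mul_const u1).const_add x1
  have hY0 : HasDerivAt (fun t : ℝ => A 0 - (z + t • a).1 0) (-v0) 0 := by
    simpa [hv0] using (((hasDerivAt_id (0 : ℝ)).mul_const v0).const_add (z.1 0)).const_sub (A 0)
  have hY1 : HasDerivAt (fun t : ℝ => A 1 - (z + t • a).1 1) (-v1) 0 := by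
    simpa [hv1] using (((hasDerivAt_id (0 : ℝ)).mul_const v1).const_add (z.1 1)).const_sub (A 1)
  have hR : HasDerivAt (fun t : ℝ => (z + t • a).2 0 ^ 2 + (z + t • a).2 1 ^ 2)
      (2 * (x0 * u0 + x1 * u1)) 0 := by
    refine ((hX0.pow 2).add (hX1.pow 2)).congr_deriv ?_
    simp [hx0, hx1]; ring
  have hS := hR.add_const 1
  have hT := (hX0.mul hY0).add (hX1.mul hY1)
  have hne : (z + (0 : ℝ) • a).2 0 ^ 2 + (z + (0 : ℝ) • a).2 1 ^ 2 + 1 ≠ 0 := by positivity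
  have hne' : x0 ^ 2 + x1 ^ 2 + 1 ≠ 0 := by positivity
  refine ⟨?_, ?_, ?_, ?_, ?_, ?_⟩
  · have h := (hasDerivAt_moserMap_line A z a 0).1
    simp only [moserMap_fst_zero] at h
    rw [h.unique ((hR.sub_const 1).div hS hne)]
    simp only [zero_smul, add_zero, hx0, hx1]
    field_simp; ring
  · have h := (hasDerivAt_moserMap_line A z a 1).1
    simp only [moserMap_fst_one] at h
    rw [h.unique ((hX0.const_mul 2).div hS hne)]
    simp only [zero_smul, add_zero, hx0, hx1]
    field_simp; ring
  · have h := (hasDerivAt_moserMap_line A z a 2).1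
    simp only [moserMap_fst_two] at h
    rw [h.unique ((hX1.const_mul 2).div hS hne)]
    simp only [zero_smul, add_zero, hx0, hx1]
    field_simp; ring
  · have h := (hasDerivAt_moserMap_line A z a 0).2
    simp only [moserMap_snd_zero] at h
    rw [h.unique hT]
    simp only [zero_smul, add_zero, hx0, hx1, hy0, hy1]
    ring
  · have h := (hasDerivAt_moserMap_line A z a 1).2
    simp only [moserMap_snd_one] at h
    rw [h.unique (((hS.div_const 2).mul hY0).sub (hT.mul hX0))]
    simp [hx0, hx1, hy0, hy1]
    ring
  · have h := (hasDerivAt_moserMap_line A z a 2).2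
    simp only [moserMap_snd_two] at h
    rw [h.unique (((hS.div_const 2).mul hY1).sub (hT.mul hX1))]
    simp [hx0, hx1, hy0, hy1]
    ring

theorem moserMap_symplectic (A : Plane) (z a b : Phase) :
    canonicalForm (fderiv ℝ (moserMap A) z a) (fderiv ℝ (moserMap A) z b) =
      canonicalForm a b := by
  obtain ⟨a1, a2, a3, a4, a5, a6⟩ := fderiv_moserMap A z a _ _ _ _ _ _ _ _ rfl rfl rfl rfl
    rfl rfl rfl rfl
  obtain ⟨b1, b2, b3, b4, b5, b6⟩ := fderiv_moserMap A z b _ _ _ _ _ _ _ _ rfl rfl rfl rfl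
    rfl rfl rfl rfl
  simp only [canonicalForm, space_inner, plane_inner]
  rw [a1, a2, a3, a4, a5, a6, b1, b2, b3, b4, b5, b6]
  have hne : z.2 0 ^ 2 + z.2 1 ^ 2 + 1 ≠ 0 := by positivity
  field_simp
  ring

theorem fderiv_moserMap_centralField (A : Plane) (z : Phase) :
    fderiv ℝ (moserMap A) z (centralField A z) = fiberField (moserMap A z) := by
  obtain ⟨a1, a2, a3, a4, a5, a6⟩ := fderiv_moserMap A z (centralField A z) _ _ _ _ 0 0 _ _
    rfl rfl rfl rfl rfl rfl rfl rfl
  refine Prod.ext (space_ext ?_ ?_ ?_) (space_ext ?_ ?_ ?_)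
  · rw [a1]; simp [fiberField]
  · rw [a2]; simp [fiberField]
  · rw [a3]; simp [fiberField]
  · rw [a4]; simp only [fiberField, moserMap_snd_zero, centralField, PiLp.sub_apply]; ring
  · rw [a5]; simp only [fiberField, moserMap_snd_one, centralField, PiLp.sub_apply]; ring
  · rw [a6]; simp only [fiberField, moserMap_snd_two, centralField, PiLp.sub_apply]; ring

theorem isLiouvilleField_centralField (A : Plane) (s : Set Phase) :
    IsLiouvilleField s (fun _ => Set.univ) (centralField A) := by
  have hd : ∀ z a, fderiv ℝ (centralField A) z a = (a.1, 0) := fun z a => by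
    have h : HasFDerivAt (centralField A) ((ContinuousLinearMap.fst ℝ Plane Plane).prod 0) z :=
      (hasFDerivAt_fst.sub_const A).prodMk (hasFDerivAt_const 0 z)
    rw [h.fderiv]; rfl
  refine ⟨(contDiff_fst.sub contDiff_const).prodMk contDiff_const, fun z _ =>
    ⟨Set.mem_univ _, fun a _ b _ => ?_⟩⟩
  simp only [lieDerivative, canonicalForm, hd]
  simp
  ring

theorem isLiouvilleField_fiberField :
    IsLiouvilleField cotangentSphere cotangentSphereTangent fiberField := by
  have hd : ∀ z a, fderiv ℝ fiberField z a = (0, a.2) := fun z a => by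
    have h : HasFDerivAt fiberField
        ((0 : Space × Space →L[ℝ] Space).prod (ContinuousLinearMap.snd ℝ Space Space)) z :=
      (hasFDerivAt_const 0 z).prodMk hasFDerivAt_snd
    rw [h.fderiv]; rfl
  refine ⟨contDiff_const.prodMk contDiff_snd, fun z hz =>
    ⟨⟨by simp [fiberField], by simpa [fiberField] using hz.2⟩, fun a _ b _ => ?_⟩⟩
  simp only [lieDerivative, canonicalForm, hd]
  simp
  ring

/-! ### The regularized Hamiltonian -/

theorem norm_displacement {w : Space × Space} (hw : w ∈ cotangentSphere) :
    ‖displacement w‖ = (1 - w.1 0) * ‖w.2‖ := by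
  obtain ⟨h1, h2⟩ := mem_cotangentSphere_iff.1 hw
  have h0 : 0 ≤ 1 - w.1 0 := by nlinarith [sq_nonneg (w.1 1), sq_nonneg (w.1 2)]
  refine (sq_eq_sq₀ (norm_nonneg _) (by positivity)).1 ?_
  rw [mul_pow, plane_norm_sq, space_norm_sq, displacement_zero, displacement_one]
  linear_combination w.2 0 ^ 2 * h1 + 2 * (1 - w.1 0) * w.2 0 * h2

/-- The data of the Euler problem as seen from one of its two centers: the mass `a` at `A`, the
mass `b` at `B`, at distance one from each other, and an energy `c` below the critical energy
`-(√a + √b)²`. -/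
structure TwoCenters where
  /-- The center at which the problem is regularized. -/
  A : Plane
  /-- The other center. -/
  B : Plane
  /-- The mass at `A`. -/
  a : ℝ
  /-- The mass at `B`. -/
  b : ℝ
  /-- The energy. -/
  c : ℝ
  ha : 0 < a
  hb : 0 < b
  hAB : ‖A - B‖ = 1
  hc : c + (√a + √b) ^ 2 < 0

namespace TwoCenters

variable (P : TwoCenters)

/-- The Hamiltonian of the Euler problem. -/
noncomputable def hamiltonian (z : Phase) : ℝ :=
  ‖z.2‖ ^ 2 / 2 - P.a / ‖z.1 - P.A‖ - P.b / ‖z.1 - P.B‖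

/-- The distance from `A` to the critical point of the potential, which lies on the segment from
`A` to `B`. -/
noncomputable def radius : ℝ := √P.a / (√P.a + √P.b)

theorem radius_pos : 0 < P.radius :=
  div_pos (Real.sqrt_pos.2 P.ha) (add_pos (Real.sqrt_pos.2 P.ha) (Real.sqrt_pos.2 P.hb))

theorem one_sub_radius : 1 - P.radius = √P.b / (√P.a + √P.b) := by
  have h : √P.a + √P.b ≠ 0 := (add_pos (Real.sqrt_pos.2 P.ha) (Real.sqrt_pos.2 P.hb)).ne'
  rw [radius]
  field_simp
  ring

theorem radius_lt_one : P.radius < 1 := by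
  have h : 0 < 1 - P.radius := by
    rw [one_sub_radius]
    exact div_pos (Real.sqrt_pos.2 P.hb) (add_pos (Real.sqrt_pos.2 P.ha) (Real.sqrt_pos.2 P.hb))
  linarith

/-- At the critical point the potential is `-(√a + √b)²`, hence larger than the energy `c`. -/
theorem energy_lt_at_radius : P.c + P.a / P.radius + P.b / (1 - P.radius) < 0 := by
  have h1 := Real.sqrt_pos.2 P.ha
  have h2 := Real.sqrt_pos.2 P.hb
  have h3 : P.a / P.radius = √P.a * (√P.a + √P.b) := by
    rw [radius]
    nth_rw 1 [← Real.mul_self_sqrt P.ha.le]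
    field_simp
  have h4 : P.b / (1 - P.radius) = √P.b * (√P.a + √P.b) := by
    rw [one_sub_radius]
    nth_rw 1 [← Real.mul_self_sqrt P.hb.le]
    field_simp
  rw [h3, h4]
  linarith [P.hc]

/-- On the side of `A` of the critical point, the attraction of `A` exceeds that of `B`. -/
theorem attraction_lt {r : ℝ} (h0 : 0 ≤ r) (h : r < P.radius) :
    P.b * r ^ 2 < P.a * (1 - r) ^ 2 := by
  have h1 := Real.sqrt_pos.2 P.ha
  have h2 := Real.sqrt_pos.2 P.hb
  rw [radius, lt_div_iff₀ (by positivity)] at h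
  have h3 : (√P.b * r) ^ 2 < (√P.a * (1 - r)) ^ 2 :=
    pow_lt_pow_left₀ (by linarith) (by positivity) two_ne_zero
  rwa [mul_pow, mul_pow, Real.sq_sqrt P.ha.le, Real.sq_sqrt P.hb.le] at h3

/-- The regularized Hamiltonian. It equals `|q - A| (H - c)` away from the collisions; since
`|q - A| = (1 - ξ₀) |η|` and `|p|² = (1 + ξ₀) / (1 - ξ₀)` on `T*S²`, it extends over them. -/
noncomputable def regularized (w : Space × Space) : ℝ :=
  ‖w.2‖ * ((1 + w.1 0) / 2 - (1 - w.1 0) * (P.c + P.b / ‖P.A - P.B - displacement w‖)) - P.a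

/-- The domain of the regularized Hamiltonian: positions closer to `A` than the critical point,
outside the zero section. -/
def domain : Set (Space × Space) := {w | w.2 ≠ 0 ∧ ‖displacement w‖ < P.radius}

/-- The regularized energy hypersurface. -/
def hypersurface : Set (Space × Space) := {w ∈ cotangentSphere ∩ P.domain | P.regularized w = 0}

/-- The component of the energy hypersurface around `A`. -/
def component : Set Phase := {z | z.1 ≠ P.A ∧ ‖z.1 - P.A‖ < P.radius ∧ P.hamiltonian z = P.c}

theorem isOpen_domain : IsOpen P.domain :=
  (isOpen_ne_fun continuous_snd continuous_const).inter
    (isOpen_lt contDiff_displacement.continuous.norm continuous_const)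

theorem le_norm_sub (y : Plane) : 1 - ‖y‖ ≤ ‖P.A - P.B - y‖ := by
  have := norm_sub_norm_le (P.A - P.B) y
  rwa [P.hAB] at this

theorem sub_ne_zero_of_norm_lt {y : Plane} (h : ‖y‖ < P.radius) : P.A - P.B - y ≠ 0 :=
  norm_pos_iff.1 (by linarith [P.le_norm_sub y, P.radius_lt_one])

theorem contDiffOn_regularized : ContDiffOn ℝ ∞ P.regularized P.domain := by
  intro w hw
  refine ContDiffAt.contDiffWithinAt ?_
  have h1 : ContDiffAt ℝ ∞ (fun w : Space × Space => ‖w.2‖) w :=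
    contDiffAt_snd.norm ℝ hw.1
  have h2 : ContDiffAt ℝ ∞ (fun w : Space × Space => ‖P.A - P.B - displacement w‖) w :=
    (contDiffAt_const.sub contDiff_displacement.contDiffAt).norm ℝ (P.sub_ne_zero_of_norm_lt hw.2)
  have h3 : ‖P.A - P.B - displacement w‖ ≠ 0 := norm_ne_zero_iff.2 (P.sub_ne_zero_of_norm_lt hw.2)
  have h4 : ContDiffAt ℝ ∞ (fun w : Space × Space => w.1 0) w := by fun_prop
  exact (h1.mul (((contDiffAt_const.add h4).div_const 2).sub ((contDiffAt_const.sub h4).mul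
    (contDiffAt_const.add (contDiffAt_const.div h2 h3))))).sub contDiffAt_const

theorem contDiffAt_regularized {w : Space × Space} (hw : w ∈ P.domain) :
    ContDiffAt ℝ ∞ P.regularized w :=
  P.contDiffOn_regularized.contDiffAt (P.isOpen_domain.mem_nhds hw)

/-- The regularized Hamiltonian along a ray of a fiber. -/
theorem regularized_smul {ξ η : Space} (hw : (ξ, η) ∈ cotangentSphere) {t : ℝ} (ht : 0 ≤ t) :
    P.regularized (ξ, t • η) = t * (‖η‖ * (1 + ξ 0) / 2 - ‖displacement (ξ, η)‖ * P.c -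
      ‖displacement (ξ, η)‖ * P.b / ‖P.A - P.B - t • displacement (ξ, η)‖) - P.a := by
  rw [regularized, displacement_smul, norm_smul, norm_displacement hw, Real.norm_of_nonneg ht]
  ring

/-- Along a ray `t ↦ (ξ, t η)` the equation `K = 0` says that this function of `t` takes a prescribed
value. It is strictly decreasing as long as the position is closer to `A` than the critical point,
because there the attraction of `A` exceeds that of `B`. -/
theorem ray_strictAnti {y : Plane} {t₁ t₂ : ℝ} (h1 : 0 < t₁) (h12 : t₁ < t₂)
    (h2 : t₂ * ‖y‖ < P.radius) :
    P.a / t₂ + ‖y‖ * P.b / ‖P.A - P.B - t₂ • y‖ < P.a / t₁ + ‖y‖ * P.b / ‖P.A - P.B - t₁ • y‖ := by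
  have hr := norm_nonneg y
  have h20 : 0 < t₂ := h1.trans h12
  have h1r : t₁ * ‖y‖ < P.radius := lt_of_le_of_lt (by gcongr) h2
  have hR := P.radius_lt_one
  have hb := P.hb
  set d₁ := ‖P.A - P.B - t₁ • y‖ with hd₁
  set d₂ := ‖P.A - P.B - t₂ • y‖ with hd₂
  have e1 : 1 - t₁ * ‖y‖ ≤ d₁ := by
    have := P.le_norm_sub (t₁ • y)
    rwa [norm_smul, Real.norm_of_nonneg h1.le] at this
  have e2 : 1 - t₂ * ‖y‖ ≤ d₂ := by
    have := P.le_norm_sub (t₂ • y)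
    rwa [norm_smul, Real.norm_of_nonneg h20.le] at this
  have p1 : 0 < 1 - t₁ * ‖y‖ := by linarith
  have p2 : 0 < 1 - t₂ * ‖y‖ := by linarith
  have hd10 : 0 < d₁ := by linarith
  have hd20 : 0 < d₂ := by linarith
  have hlip : d₁ - d₂ ≤ (t₂ - t₁) * ‖y‖ := by
    refine (norm_sub_norm_le _ _).trans ?_
    rw [show P.A - P.B - t₁ • y - (P.A - P.B - t₂ • y) = (t₂ - t₁) • y by module, norm_smul,
      Real.norm_of_nonneg (by linarith)]
  have f1 := P.attraction_lt (by positivity) h1r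
  have f2 := P.attraction_lt (by positivity) h2
  -- the geometric mean of the two inequalities `f1` and `f2`
  have f : P.b * (t₁ * ‖y‖) * (t₂ * ‖y‖) < P.a * ((1 - t₁ * ‖y‖) * (1 - t₂ * ‖y‖)) := by
    have ha := P.ha
    refine lt_of_pow_lt_pow_left₀ 2 (by positivity) ?_
    have := mul_lt_mul'' f1 f2 (by positivity) (by positivity)
    calc _ = P.b * (t₁ * ‖y‖) ^ 2 * (P.b * (t₂ * ‖y‖) ^ 2) := by ring
      _ < _ := this
      _ = _ := by ring
  have g : P.b * (t₁ * ‖y‖) * (t₂ * ‖y‖) < P.a * (d₁ * d₂) :=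
    f.trans_le (mul_le_mul_of_nonneg_left (mul_le_mul e1 e2 p2.le hd10.le) P.ha.le)
  have key : ‖y‖ * P.b / d₂ - ‖y‖ * P.b / d₁ < P.a / t₁ - P.a / t₂ := by
    have k1 : ‖y‖ * P.b / d₂ - ‖y‖ * P.b / d₁ ≤ ‖y‖ * P.b * ((t₂ - t₁) * ‖y‖) / (d₁ * d₂) := by
      rw [show ‖y‖ * P.b / d₂ - ‖y‖ * P.b / d₁ = ‖y‖ * P.b * (d₁ - d₂) / (d₁ * d₂) by field_simp]
      gcongr
    refine k1.trans_lt ?_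
    rw [show P.a / t₁ - P.a / t₂ = P.a * (t₂ - t₁) / (t₁ * t₂) by field_simp,
      div_lt_div_iff₀ (by positivity) (by positivity)]
    have := mul_lt_mul_of_pos_left g (sub_pos.2 h12)
    linarith
  linarith

theorem smul_mem_cotangentSphere {ξ η : Space} (hw : (ξ, η) ∈ cotangentSphere) (t : ℝ) :
    (ξ, t • η) ∈ cotangentSphere :=
  ⟨hw.1, by
    have h : inner ℝ ξ η = 0 := hw.2
    simp [inner_smul_right, h]⟩

theorem one_add_fst_nonneg {w : Space × Space} (hw : w ∈ cotangentSphere) : 0 ≤ 1 + w.1 0 := by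
  obtain ⟨h1, -⟩ := mem_cotangentSphere_iff.1 hw
  nlinarith [sq_nonneg (w.1 1), sq_nonneg (w.1 2)]

/-- Every ray meets the regularized hypersurface, by the intermediate value theorem: the regularized
Hamiltonian is `-a` at the zero section, and it is positive where the position reaches the distance
of the critical point from `A`. A ray over the north pole consists of collisions, and there the
regularized Hamiltonian is `|η| - a`. -/
theorem exists_smul_mem_hypersurface {ξ η : Space} (hw : (ξ, η) ∈ cotangentSphere) (hη : η ≠ 0) :
    ∃ t : ℝ, 0 < t ∧ (ξ, t • η) ∈ P.hypersurface := by
  set y := displacement (ξ, η) with hy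
  have hy0 := norm_nonneg y
  have hη0 := norm_pos_iff.2 hη
  have hR0 := P.radius_pos
  have ha := P.ha
  have hnorm : ‖y‖ = (1 - ξ 0) * ‖η‖ := norm_displacement hw
  obtain ⟨T, hT0, hTr, hT⟩ : ∃ T, 0 < T ∧ T * ‖y‖ ≤ P.radius ∧ 0 < P.regularized (ξ, T • η) := by
    rcases hy0.eq_or_lt with h | h
    · refine ⟨2 * P.a / ‖η‖, by positivity, by rw [← h, mul_zero]; exact hR0.le, ?_⟩
      have hξ : 1 - ξ 0 = 0 := by
        rw [hnorm] at h
        exact (mul_eq_zero.1 h.symm).resolve_right hη0.ne'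
      rw [P.regularized_smul hw (by positivity), ← hy, ← h, show ξ 0 = 1 by linarith]
      have : 2 * P.a / ‖η‖ * (‖η‖ * (1 + 1) / 2 - 0 * P.c -
        0 * P.b / ‖P.A - P.B - (2 * P.a / ‖η‖) • y‖) - P.a = P.a := by
        field_simp; ring
      rw [this]
      exact ha
    · have hTy : P.radius / ‖y‖ * ‖y‖ = P.radius := div_mul_cancel₀ _ h.ne'
      refine ⟨P.radius / ‖y‖, by positivity, hTy.le, ?_⟩
      rw [P.regularized_smul hw (by positivity), ← hy]
      have hd : 1 - P.radius ≤ ‖P.A - P.B - (P.radius / ‖y‖) • y‖ := by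
        have := P.le_norm_sub ((P.radius / ‖y‖) • y)
        rwa [norm_smul, Real.norm_of_nonneg (by positivity), hTy] at this
      have hp : 0 < 1 - P.radius := by linarith [P.radius_lt_one]
      have hb := P.hb
      have hinv : P.b / ‖P.A - P.B - (P.radius / ‖y‖) • y‖ ≤ P.b / (1 - P.radius) := by gcongr
      have h1 := one_add_fst_nonneg hw
      have h1' : 0 ≤ P.radius / ‖y‖ * (‖η‖ * (1 + ξ 0) / 2) := by positivity
      have h2 := P.energy_lt_at_radius
      have h3 : P.radius * (P.c + P.b / ‖P.A - P.B - (P.radius / ‖y‖) • y‖) < - P.a := by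
        have : P.c + P.b / ‖P.A - P.B - (P.radius / ‖y‖) • y‖ < -(P.a / P.radius) := by linarith
        calc _ < P.radius * -(P.a / P.radius) := by gcongr
          _ = - P.a := by field_simp
      calc 0 < P.radius / ‖y‖ * (‖η‖ * (1 + ξ 0) / 2) -
            P.radius * (P.c + P.b / ‖P.A - P.B - (P.radius / ‖y‖) • y‖) - P.a := by linarith
        _ = P.radius / ‖y‖ * (‖η‖ * (1 + ξ 0) / 2) - P.radius / ‖y‖ * ‖y‖ *
            (P.c + P.b / ‖P.A - P.B - (P.radius / ‖y‖) • y‖) - P.a := by rw [hTy]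
        _ = _ := by ring
  have hlt : ∀ t ∈ Set.Icc 0 T, P.A - P.B - displacement (ξ, t • η) ≠ 0 := by
    intro t ht
    refine norm_pos_iff.1 ?_
    have := P.le_norm_sub (t • y)
    rw [norm_smul, Real.norm_of_nonneg ht.1] at this
    rw [displacement_smul]
    have h4 : t * ‖y‖ ≤ T * ‖y‖ := mul_le_mul_of_nonneg_right ht.2 hy0
    linarith [P.radius_lt_one]
  have hcont : ContinuousOn (fun t : ℝ => P.regularized (ξ, t • η)) (Set.Icc 0 T) := by
    have hd : Continuous fun t : ℝ => displacement (ξ, t • η) :=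
      contDiff_displacement.continuous.comp (by fun_prop)
    have hdiv : ContinuousOn (fun t : ℝ => P.b / ‖P.A - P.B - displacement (ξ, t • η)‖)
        (Set.Icc 0 T) :=
      continuousOn_const.div (continuous_const.sub hd).norm.continuousOn
        fun t ht => norm_ne_zero_iff.2 (hlt t ht)
    simp only [regularized]
    fun_prop
  have h0 : P.regularized (ξ, (0 : ℝ) • η) < 0 := by
    rw [P.regularized_smul hw le_rfl]
    linarith
  obtain ⟨t, ⟨ht0, htT⟩, ht⟩ := intermediate_value_Ioo hT0.le hcont ⟨h0, hT⟩
  refine ⟨t, ht0, ⟨smul_mem_cotangentSphere hw t, smul_ne_zero ht0.ne' hη, ?_⟩, ht⟩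
  rw [displacement_smul, norm_smul, Real.norm_of_nonneg ht0.le]
  rcases hy0.eq_or_lt with h | h
  · rw [← hy, ← h, mul_zero]
    exact hR0
  · exact (mul_lt_mul_of_pos_right htT h).trans_le hTr

theorem smul_mem_hypersurface_unique {ξ η : Space} (hw : (ξ, η) ∈ cotangentSphere) {t₁ t₂ : ℝ}
    (h1 : 0 < t₁) (h2 : 0 < t₂) (m1 : (ξ, t₁ • η) ∈ P.hypersurface)
    (m2 : (ξ, t₂ • η) ∈ P.hypersurface) : t₁ = t₂ := by
  have hdom : ∀ t, 0 < t → (ξ, t • η) ∈ P.hypersurface →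
      t * ‖displacement (ξ, η)‖ < P.radius := by
    intro t ht hm
    have := hm.1.2.2
    rwa [displacement_smul, norm_smul, Real.norm_of_nonneg ht.le] at this
  have heq : ∀ t, 0 < t → (ξ, t • η) ∈ P.hypersurface →
      P.a / t + ‖displacement (ξ, η)‖ * P.b / ‖P.A - P.B - t • displacement (ξ, η)‖ =
        ‖η‖ * (1 + ξ 0) / 2 - ‖displacement (ξ, η)‖ * P.c := by
    intro t ht hm
    have := hm.2
    rw [P.regularized_smul hw ht.le, sub_eq_zero, mul_comm] at this
    have := (eq_div_iff ht.ne').2 this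
    linarith
  rcases lt_trichotomy t₁ t₂ with h | h | h
  · have := P.ray_strictAnti h1 h (hdom _ h2 m2)
    rw [heq _ h1 m1, heq _ h2 m2] at this
    exact absurd this (lt_irrefl _)
  · exact h
  · have := P.ray_strictAnti h2 h (hdom _ h1 m1)
    rw [heq _ h1 m1, heq _ h2 m2] at this
    exact absurd this (lt_irrefl _)

theorem isFiberwiseStarShaped_hypersurface : IsFiberwiseStarShaped P.hypersurface := by
  refine ⟨fun w hw => hw.1.1, fun w hw => hw.1.2.1, fun ξ η hw hη => ?_⟩
  obtain ⟨t, ht, hm⟩ := P.exists_smul_mem_hypersurface hw hη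
  exact ⟨t, ⟨ht, hm⟩, fun s hs => P.smul_mem_hypersurface_unique hw hs.1 ht hs.2 hm⟩

/-- The regularized Hamiltonian increases along the field `η ∂_η`. -/
theorem fderiv_regularized_fiberField_pos {w : Space × Space} (hw : w ∈ P.hypersurface) :
    0 < fderiv ℝ P.regularized w (fiberField w) := by
  obtain ⟨ξ, η⟩ := w
  set y := displacement (ξ, η) with hy
  have hyR : ‖y‖ < P.radius := hw.1.2.2
  have hne : P.A - P.B - (1 : ℝ) • y ≠ 0 := by
    rw [one_smul]; exact P.sub_ne_zero_of_norm_lt hyR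
  have hcurve : HasDerivAt (fun t : ℝ => (ξ, t • η)) (fiberField (ξ, η)) 1 := by
    have := (hasDerivAt_const (1 : ℝ) ξ).prodMk ((hasDerivAt_id (1 : ℝ)).smul_const η)
    simpa [fiberField] using this
  have hK : HasDerivAt (fun t : ℝ => P.regularized (ξ, t • η))
      (fderiv ℝ P.regularized (ξ, η) (fiberField (ξ, η))) 1 := by
    have h1 : HasFDerivAt P.regularized (fderiv ℝ P.regularized (ξ, η)) (ξ, (1 : ℝ) • η) := by
      rw [one_smul]
      exact ((P.contDiffAt_regularized hw.1.2).differentiableAt (by simp)).hasFDerivAt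
    exact h1.comp_hasDerivAt 1 hcurve
  have hline : HasDerivAt (fun t : ℝ => P.A - P.B - t • y) (-y) 1 := by
    simpa using ((hasDerivAt_id (1 : ℝ)).smul_const y).const_sub (P.A - P.B)
  set f : ℝ → ℝ := fun t => ‖P.A - P.B - t • y‖ with hf
  have hfd : HasDerivAt f (deriv f 1) 1 :=
    (hline.differentiableAt.norm ℝ hne).hasDerivAt
  -- the distance to `B` changes along the ray at most at the speed `|y|` of the position
  have hbound : |deriv f 1| ≤ ‖y‖ := by
    refine norm_deriv_le_of_lipschitz (f := f) (C := ‖y‖₊) (LipschitzWith.of_dist_le_mul ?_)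
    intro s t
    rw [Real.dist_eq]
    refine (abs_norm_sub_norm_le _ _).trans ?_
    rw [show P.A - P.B - s • y - (P.A - P.B - t • y) = (t - s) • y by module, norm_smul,
      dist_comm, Real.dist_eq, Real.norm_eq_abs, coe_nnnorm, mul_comm]
  have hf1 : f 1 ≠ 0 := norm_ne_zero_iff.2 hne
  have hK' := ((hasDerivAt_id (1 : ℝ)).mul
    (((hasDerivAt_const (1 : ℝ) (‖y‖ * P.b)).div hfd hf1).const_sub
      (‖η‖ * (1 + ξ 0) / 2 - ‖y‖ * P.c))).sub_const P.a
  have hev : (fun t : ℝ => P.regularized (ξ, t • η)) =ᶠ[𝓝 1] _ :=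
    Filter.eventuallyEq_of_mem (Ioi_mem_nhds one_pos) fun t ht =>
      P.regularized_smul hw.1.1 (le_of_lt ht)
  rw [hK.unique (hK'.congr_of_eventuallyEq hev)]
  have hzero := P.regularized_smul hw.1.1 zero_le_one
  rw [one_smul, hw.2, one_mul, ← hy] at hzero
  change 0 = _ - ‖y‖ * P.b / f 1 - P.a at hzero
  have hf0 : 1 - ‖y‖ ≤ f 1 := by
    have := P.le_norm_sub ((1 : ℝ) • y)
    rwa [show ‖(1 : ℝ) • y‖ = ‖y‖ by rw [one_smul]] at this
  have hp : 0 < 1 - ‖y‖ := by linarith [P.radius_lt_one]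
  have hatt := P.attraction_lt (norm_nonneg y) hyR
  have hb := P.hb
  have hfpos : 0 < f 1 := by linarith
  have hmain : -(P.a) < ‖y‖ * P.b * deriv f 1 / f 1 ^ 2 := by
    rw [lt_div_iff₀ (by positivity)]
    have h1 : -(P.b * ‖y‖ ^ 2) ≤ ‖y‖ * P.b * deriv f 1 := by
      have := mul_le_mul_of_nonneg_left (neg_le_of_abs_le hbound)
        (mul_nonneg (norm_nonneg y) hb.le)
      linarith
    have h2 : P.a * (1 - ‖y‖) ^ 2 ≤ P.a * f 1 ^ 2 := by
      have := P.ha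
      gcongr
    linarith
  simp only [id, one_mul, zero_mul, zero_sub, neg_div, neg_neg, Pi.div_apply]
  linarith

/-! ### The energy hypersurface under Moser's map -/

/-- The regularized Hamiltonian is `|q - A| (H - c)`. -/
theorem regularized_moserMap {z : Phase} (hz : z.1 ≠ P.A) :
    P.regularized (moserMap P.A z) = ‖z.1 - P.A‖ * (P.hamiltonian z - P.c) := by
  have h1 := norm_displacement (moserMap_mem_cotangentSphere P.A z)
  rw [displacement_moserMap, norm_sub_rev] at h1
  have h2 : (1 + (moserMap P.A z).1 0) = (1 - (moserMap P.A z).1 0) * ‖z.2‖ ^ 2 := by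
    rw [one_sub_moserMap_fst_zero, moserMap_fst_zero, plane_norm_sq]
    have : z.2 0 ^ 2 + z.2 1 ^ 2 + 1 ≠ 0 := by positivity
    field_simp
    ring
  have h3 : P.A - P.B - (P.A - z.1) = z.1 - P.B := by abel
  have h4 : ‖z.1 - P.A‖ ≠ 0 := norm_ne_zero_iff.2 (sub_ne_zero.2 hz)
  rw [regularized, displacement_moserMap, h3, h2, hamiltonian]
  have h5 : ‖z.1 - P.A‖ * (P.a / ‖z.1 - P.A‖) = P.a := mul_div_cancel₀ _ h4
  linear_combination (-(‖z.2‖ ^ 2 / 2 - P.c - P.b / ‖z.1 - P.B‖)) * h1 + h5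

theorem moserMap_image_component :
    moserMap P.A '' P.component = {w ∈ P.hypersurface | w.1 ≠ northPole} := by
  ext w
  constructor
  · rintro ⟨z, ⟨hzA, hzR, hzc⟩, rfl⟩
    refine ⟨⟨⟨moserMap_mem_cotangentSphere _ _, ?_, ?_⟩, ?_⟩, moserMap_fst_ne_northPole _ _⟩
    · intro h
      have := norm_displacement (moserMap_mem_cotangentSphere P.A z)
      rw [h, norm_zero, mul_zero, displacement_moserMap, norm_eq_zero, sub_eq_zero] at this
      exact hzA this.symm
    · rwa [displacement_moserMap, norm_sub_rev]
    · rw [P.regularized_moserMap hzA, hzc, sub_self, mul_zero]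
  · rintro ⟨hw, hN⟩
    obtain ⟨z, rfl⟩ : w ∈ Set.range (moserMap P.A) := by
      rw [range_moserMap]
      exact ⟨hw.1.1, hN⟩
    have hpos : 0 < ‖z.1 - P.A‖ := by
      have := norm_displacement (moserMap_mem_cotangentSphere P.A z)
      rw [displacement_moserMap, norm_sub_rev] at this
      rw [this]
      exact mul_pos ((ne_northPole_iff hw.1.1).1 hN) (norm_pos_iff.2 hw.1.2.1)
    have hzA : z.1 ≠ P.A := sub_ne_zero.1 (norm_pos_iff.1 hpos)
    refine ⟨z, ⟨hzA, ?_, ?_⟩, rfl⟩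
    · have := hw.1.2.2
      rwa [displacement_moserMap, norm_sub_rev] at this
    · have := hw.2
      rw [P.regularized_moserMap hzA] at this
      exact sub_eq_zero.1 ((mul_eq_zero.1 this).resolve_left hpos.ne')

end TwoCenters

/-! ### The two-fold cover of the unit cotangent bundle by the three-sphere -/

/-- The coordinate space `ℝ⁴ = ℂ²`, a point of which is a pair `(z, w)` with
`z = x₀ + i x₁` and `w = x₂ + i x₃`. -/
abbrev SpinorSpace : Type := EuclideanSpace ℝ (Fin 4)

/-- The Hopf map `(|z|² - |w|², 2 z w)`. -/
noncomputable def spinBase (x : SpinorSpace) : Space :=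
  !₂[x 0 ^ 2 + x 1 ^ 2 - x 2 ^ 2 - x 3 ^ 2, 2 * (x 0 * x 2 - x 1 * x 3),
    2 * (x 0 * x 3 + x 1 * x 2)]

/-- The covector `(2 Re(z̄ w), w² - z²)`. It is the one that Moser's map assigns to the momentum
`p = z / w̄` and to the displacement `2 w²`, as in the Levi-Civita regularization. -/
noncomputable def spinFiber (x : SpinorSpace) : Space :=
  !₂[2 * (x 0 * x 2 + x 1 * x 3), x 2 ^ 2 - x 3 ^ 2 - x 0 ^ 2 + x 1 ^ 2,
    2 * (x 2 * x 3 - x 0 * x 1)]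

theorem spinBase_zero (x : SpinorSpace) :
    spinBase x 0 = x 0 ^ 2 + x 1 ^ 2 - x 2 ^ 2 - x 3 ^ 2 := rfl
theorem spinBase_one (x : SpinorSpace) : spinBase x 1 = 2 * (x 0 * x 2 - x 1 * x 3) := rfl
theorem spinBase_two (x : SpinorSpace) : spinBase x 2 = 2 * (x 0 * x 3 + x 1 * x 2) := rfl
theorem spinFiber_zero (x : SpinorSpace) : spinFiber x 0 = 2 * (x 0 * x 2 + x 1 * x 3) := rfl
theorem spinFiber_one (x : SpinorSpace) :
    spinFiber x 1 = x 2 ^ 2 - x 3 ^ 2 - x 0 ^ 2 + x 1 ^ 2 := rfl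
theorem spinFiber_two (x : SpinorSpace) : spinFiber x 2 = 2 * (x 2 * x 3 - x 0 * x 1) := rfl

theorem contDiff_spinBase : ContDiff ℝ ∞ spinBase := by
  refine contDiff_euclidean.2 fun i => ?_
  fin_cases i
  · change ContDiff ℝ ∞ fun x => spinBase x 0
    simp only [spinBase_zero]; fun_prop
  · change ContDiff ℝ ∞ fun x => spinBase x 1
    simp only [spinBase_one]; fun_prop
  · change ContDiff ℝ ∞ fun x => spinBase x 2
    simp only [spinBase_two]; fun_prop

theorem contDiff_spinFiber : ContDiff ℝ ∞ spinFiber := by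
  refine contDiff_euclidean.2 fun i => ?_
  fin_cases i
  · change ContDiff ℝ ∞ fun x => spinFiber x 0
    simp only [spinFiber_zero]; fun_prop
  · change ContDiff ℝ ∞ fun x => spinFiber x 1
    simp only [spinFiber_one]; fun_prop
  · change ContDiff ℝ ∞ fun x => spinFiber x 2
    simp only [spinFiber_two]; fun_prop

theorem spinor_norm_sq (x : SpinorSpace) :
    ‖x‖ ^ 2 = x 0 ^ 2 + x 1 ^ 2 + x 2 ^ 2 + x 3 ^ 2 := by
  simp [EuclideanSpace.real_norm_sq_eq, Fin.sum_univ_four]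

theorem spinor_ext {x y : SpinorSpace} (h0 : x 0 = y 0) (h1 : x 1 = y 1) (h2 : x 2 = y 2)
    (h3 : x 3 = y 3) : x = y := by
  ext i; fin_cases i <;> assumption

theorem threeSphere_sum_sq (x : ThreeSphere) :
    x.1 0 ^ 2 + x.1 1 ^ 2 + x.1 2 ^ 2 + x.1 3 ^ 2 = 1 := by
  rw [← spinor_norm_sq, norm_eq_of_mem_sphere x, one_pow]

theorem spin_mem_cotangentSphere (x : ThreeSphere) :
    (spinBase x, spinFiber x) ∈ cotangentSphere := by
  have h := threeSphere_sum_sq x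
  rw [mem_cotangentSphere_iff]
  simp only [spinBase_zero, spinBase_one, spinBase_two, spinFiber_zero, spinFiber_one,
    spinFiber_two]
  constructor
  · linear_combination (x.1 0 ^ 2 + x.1 1 ^ 2 + x.1 2 ^ 2 + x.1 3 ^ 2 + 1) * h
  · ring

theorem norm_spinFiber (x : ThreeSphere) : ‖spinFiber x‖ = 1 := by
  have h := threeSphere_sum_sq x
  refine (pow_eq_one_iff_of_nonneg (norm_nonneg _) two_ne_zero).1 ?_
  rw [space_norm_sq]
  simp only [spinFiber_zero, spinFiber_one, spinFiber_two]
  linear_combination (x.1 0 ^ 2 + x.1 1 ^ 2 + x.1 2 ^ 2 + x.1 3 ^ 2 + 1) * h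

theorem spinFiber_ne_zero (x : ThreeSphere) : spinFiber x ≠ 0 :=
  norm_ne_zero_iff.1 (by rw [norm_spinFiber]; exact one_ne_zero)

theorem one_sub_spinBase_zero (x : ThreeSphere) :
    1 - spinBase x 0 = 2 * (x.1 2 ^ 2 + x.1 3 ^ 2) := by
  rw [spinBase_zero]
  linear_combination -threeSphere_sum_sq x

theorem spinBase_ne_northPole_iff (x : ThreeSphere) :
    spinBase x ≠ northPole ↔ x.1 2 ^ 2 + x.1 3 ^ 2 ≠ 0 := by
  rw [ne_northPole_iff (spin_mem_cotangentSphere x)]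
  change 0 < 1 - spinBase x 0 ↔ _
  rw [one_sub_spinBase_zero]
  constructor
  · intro h h'
    rw [h'] at h
    simp at h
  · intro h
    positivity

/-- The displacement of the covector is `2 w²`. -/
theorem displacement_spin (x : ThreeSphere) :
    displacement (spinBase x, spinFiber x) =
      !₂[2 * (x.1 2 ^ 2 - x.1 3 ^ 2), 4 * (x.1 2 * x.1 3)] := by
  have h := threeSphere_sum_sq x
  apply plane_ext
  · change (1 - spinBase x 0) * spinFiber x 1 + spinBase x 1 * spinFiber x 0 =
      2 * (x.1 2 ^ 2 - x.1 3 ^ 2)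
    rw [one_sub_spinBase_zero, spinBase_one, spinFiber_zero, spinFiber_one]
    linear_combination 2 * (x.1 2 ^ 2 - x.1 3 ^ 2) * h
  · change (1 - spinBase x 0) * spinFiber x 2 + spinBase x 2 * spinFiber x 0 =
      4 * (x.1 2 * x.1 3)
    rw [one_sub_spinBase_zero, spinBase_two, spinFiber_zero, spinFiber_two]
    linear_combination 4 * (x.1 2 * x.1 3) * h

theorem exists_complex_sq (u v : ℝ) :
    ∃ s t : ℝ, s ^ 2 - t ^ 2 = u ∧ 2 * (s * t) = v := by
  obtain ⟨z, hz⟩ := IsAlgClosed.exists_pow_nat_eq (⟨u, v⟩ : ℂ) two_pos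
  refine ⟨z.re, z.im, ?_, ?_⟩
  · have := congrArg Complex.re hz
    simp only [pow_two, Complex.mul_re] at this
    linarith
  · have := congrArg Complex.im hz
    simp only [pow_two, Complex.mul_im] at this
    linarith

theorem complex_sq_eq {s t s' t' : ℝ} (h1 : s ^ 2 - t ^ 2 = s' ^ 2 - t' ^ 2)
    (h2 : s * t = s' * t') : (s = s' ∧ t = t') ∨ (s = -s' ∧ t = -t') := by
  have h : (⟨s, t⟩ : ℂ) ^ 2 = (⟨s', t'⟩ : ℂ) ^ 2 := by
    apply Complex.ext
    · simp only [pow_two, Complex.mul_re]; linarith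
    · simp only [pow_two, Complex.mul_im]; linarith
  rcases sq_eq_sq_iff_eq_or_eq_neg.1 h with h | h
  · exact Or.inl ⟨congrArg Complex.re h, congrArg Complex.im h⟩
  · exact Or.inr ⟨congrArg Complex.re h, congrArg Complex.im h⟩

/-- Every unit covector is in the image: away from the north pole `w` is a square root of half the
displacement, and then `z = ξ' / (2 w)`; over the north pole `w = 0` and `z` is a square root of
`-v'`. -/
theorem exists_spin_eq {ξ v : Space} (h : (ξ, v) ∈ cotangentSphere) (hv : ‖v‖ = 1) :
    ∃ x : ThreeSphere, spinBase x = ξ ∧ spinFiber x = v := by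
  have h' := mem_cotangentSphere_iff.1 h
  simp only at h'
  have hv2 : v 0 ^ 2 + v 1 ^ 2 + v 2 ^ 2 = 1 := by rw [← space_norm_sq, hv, one_pow]
  by_cases hN : ξ = northPole
  · have h0 : ξ 0 = 1 := by rw [hN]; rfl
    have h1 : ξ 1 = 0 := by rw [hN]; rfl
    have h2 : ξ 2 = 0 := by rw [hN]; rfl
    have v0 : v 0 = 0 := by simpa [h0, h1, h2] using h'.2
    obtain ⟨s, t, hst, hst'⟩ := exists_complex_sq (-v 1) (-v 2)
    have hsum : s ^ 2 + t ^ 2 = 1 := by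
      refine (pow_eq_one_iff_of_nonneg (by positivity) two_ne_zero).1 ?_
      rw [v0] at hv2
      linear_combination hv2 + (s ^ 2 - t ^ 2 - v 1) * hst + (2 * (s * t) - v 2) * hst'
    refine ⟨⟨!₂[s, t, 0, 0], ?_⟩, ?_, ?_⟩
    · rw [mem_sphere_zero_iff_norm, ← pow_eq_one_iff_of_nonneg (norm_nonneg _) two_ne_zero,
        spinor_norm_sq]
      simpa using hsum
    · refine space_ext ?_ ?_ ?_
      · rw [spinBase_zero, h0]; simpa using hsum
      · rw [spinBase_one, h1]; simp
      · rw [spinBase_two, h2]; simp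
    · refine space_ext ?_ ?_ ?_
      · rw [spinFiber_zero, v0]; simp
      · rw [spinFiber_one]; simp; linarith
      · rw [spinFiber_two]; simp; linarith
  · have hpos : 0 < 1 - ξ 0 := (ne_northPole_iff h).1 hN
    obtain ⟨s, t, hst, hst'⟩ :=
      exists_complex_sq (displacement (ξ, v) 0 / 2) (displacement (ξ, v) 1 / 2)
    have hd := norm_displacement h
    rw [hv, mul_one] at hd
    have hd2 : displacement (ξ, v) 0 ^ 2 + displacement (ξ, v) 1 ^ 2 = (1 - ξ 0) ^ 2 := by
      rw [← plane_norm_sq, hd]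
    have hsum : s ^ 2 + t ^ 2 = (1 - ξ 0) / 2 := by
      refine (sq_eq_sq₀ (by positivity) (by positivity)).1 ?_
      linear_combination hd2 / 4 + (s ^ 2 - t ^ 2 + displacement (ξ, v) 0 / 2) * hst +
        (2 * (s * t) + displacement (ξ, v) 1 / 2) * hst'
    -- the two components of `z = ξ' / (2 w)`, where `2 |w|² = 1 - ξ₀`
    set m := (ξ 1 * s + ξ 2 * t) / (1 - ξ 0) with hm
    set n := (ξ 2 * s - ξ 1 * t) / (1 - ξ 0) with hn
    have e1 : 2 * (m * s - n * t) = ξ 1 := by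
      rw [hm, hn]
      field_simp
      linear_combination 2 * ξ 1 * hsum
    have e2 : 2 * (m * t + n * s) = ξ 2 := by
      rw [hm, hn]
      field_simp
      linear_combination 2 * ξ 2 * hsum
    have e0 : m ^ 2 + n ^ 2 = (1 + ξ 0) / 2 := by
      have : (m ^ 2 + n ^ 2) * (1 - ξ 0) ^ 2 = (1 + ξ 0) / 2 * (1 - ξ 0) ^ 2 := by
        have : (m ^ 2 + n ^ 2) * (1 - ξ 0) ^ 2 = (ξ 1 ^ 2 + ξ 2 ^ 2) * (s ^ 2 + t ^ 2) := by
          rw [hm, hn]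
          field_simp
          ring
        rw [this, hsum]
        linear_combination (1 - ξ 0) / 2 * h'.1
      exact mul_right_cancel₀ (by positivity) this
    let x : ThreeSphere := ⟨!₂[m, n, s, t], by
      rw [mem_sphere_zero_iff_norm, ← pow_eq_one_iff_of_nonneg (norm_nonneg _) two_ne_zero,
        spinor_norm_sq]
      change m ^ 2 + n ^ 2 + s ^ 2 + t ^ 2 = 1
      linarith⟩
    have hξ : spinBase x = ξ := by
      refine space_ext ?_ e1 e2
      change m ^ 2 + n ^ 2 - s ^ 2 - t ^ 2 = ξ 0
      linarith
    refine ⟨x, hξ, eq_of_displacement_eq (ξ := ξ) ?_ h hpos ?_⟩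
    · rw [← hξ]
      exact spin_mem_cotangentSphere x
    · nth_rw 1 [← hξ]
      rw [displacement_spin]
      refine plane_ext ?_ ?_
      · change 2 * (s ^ 2 - t ^ 2) = _
        linarith
      · change 4 * (s * t) = _
        linarith

theorem spin_neg (x : SpinorSpace) : spinBase (-x) = spinBase x ∧ spinFiber (-x) = spinFiber x := by
  constructor
  · refine space_ext ?_ ?_ ?_ <;> simp [spinBase]
  · refine space_ext ?_ ?_ ?_ <;> simp [spinFiber]

/-- Two points of the sphere with the same unit covector are equal or antipodal. -/
theorem eq_or_eq_neg_of_spin_eq {x y : ThreeSphere} (hb : spinBase x = spinBase y)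
    (hf : spinFiber x = spinFiber y) : x = y ∨ x = -y := by
  have hd : displacement (spinBase x, spinFiber x) = displacement (spinBase y, spinFiber y) := by
    rw [hb, hf]
  rw [displacement_spin, displacement_spin] at hd
  have hd0 : 2 * (x.1 2 ^ 2 - x.1 3 ^ 2) = 2 * (y.1 2 ^ 2 - y.1 3 ^ 2) :=
    congrArg (fun u : Plane => u 0) hd
  have hd1 : 4 * (x.1 2 * x.1 3) = 4 * (y.1 2 * y.1 3) := congrArg (fun u : Plane => u 1) hd
  have hb1 : 2 * (x.1 0 * x.1 2 - x.1 1 * x.1 3) = 2 * (y.1 0 * y.1 2 - y.1 1 * y.1 3) :=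
    congrArg (fun u : Space => u 1) hb
  have hb2 : 2 * (x.1 0 * x.1 3 + x.1 1 * x.1 2) = 2 * (y.1 0 * y.1 3 + y.1 1 * y.1 2) :=
    congrArg (fun u : Space => u 2) hb
  have hf1 : x.1 2 ^ 2 - x.1 3 ^ 2 - x.1 0 ^ 2 + x.1 1 ^ 2 =
      y.1 2 ^ 2 - y.1 3 ^ 2 - y.1 0 ^ 2 + y.1 1 ^ 2 := congrArg (fun u : Space => u 1) hf
  have hf2 : 2 * (x.1 2 * x.1 3 - x.1 0 * x.1 1) = 2 * (y.1 2 * y.1 3 - y.1 0 * y.1 1) :=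
    congrArg (fun u : Space => u 2) hf
  have hw := complex_sq_eq (s := x.1 2) (t := x.1 3) (s' := y.1 2) (t' := y.1 3)
    (by linarith) (by linarith)
  have hz := complex_sq_eq (s := x.1 0) (t := x.1 1) (s' := y.1 0) (t' := y.1 1)
    (by linarith) (by linarith)
  by_cases hy : y.1 2 ^ 2 + y.1 3 ^ 2 = 0
  · have y2 : y.1 2 = 0 := by nlinarith [sq_nonneg (y.1 2), sq_nonneg (y.1 3)]
    have y3 : y.1 3 = 0 := by nlinarith [sq_nonneg (y.1 2), sq_nonneg (y.1 3)]
    have x2 : x.1 2 = 0 := by rcases hw with h | h <;> simp [h.1, y2]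
    have x3 : x.1 3 = 0 := by rcases hw with h | h <;> simp [h.2, y3]
    rcases hz with h | h
    · exact Or.inl (Subtype.ext (spinor_ext h.1 h.2 (x2.trans y2.symm) (x3.trans y3.symm)))
    · exact Or.inr (Subtype.ext (spinor_ext h.1 h.2 (by simp [x2, y2]) (by simp [x3, y3])))
  · -- `z w` determines `z` when `w ≠ 0`
    have hcancel : ∀ m n m' n' : ℝ, m * y.1 2 - n * y.1 3 = m' * y.1 2 - n' * y.1 3 →
        m * y.1 3 + n * y.1 2 = m' * y.1 3 + n' * y.1 2 → m = m' ∧ n = n' := by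
      intro m n m' n' h1 h2
      constructor
      · refine mul_right_cancel₀ hy ?_
        linear_combination y.1 2 * h1 + y.1 3 * h2
      · refine mul_right_cancel₀ hy ?_
        linear_combination y.1 2 * h2 - y.1 3 * h1
    rcases hw with ⟨h2, h3⟩ | ⟨h2, h3⟩
    · rw [h2, h3] at hb1 hb2
      obtain ⟨h0, h1⟩ := hcancel (x.1 0) (x.1 1) (y.1 0) (y.1 1) (by linarith) (by linarith)
      exact Or.inl (Subtype.ext (spinor_ext h0 h1 h2 h3))
    · rw [h2, h3] at hb1 hb2
      obtain ⟨h0, h1⟩ := hcancel (-x.1 0) (-x.1 1) (y.1 0) (y.1 1) (by linarith) (by linarith)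
      exact Or.inr (Subtype.ext (spinor_ext (neg_eq_iff_eq_neg.1 h0) (neg_eq_iff_eq_neg.1 h1)
        h2 h3))

theorem fderiv_apply_of_hasDerivAt {f : SpinorSpace → Space} (hf : ContDiff ℝ ∞ f)
    {x u : SpinorSpace} {i : Fin 3} {d : ℝ} (h : HasDerivAt (fun t : ℝ => f (x + t • u) i) d 0) :
    fderiv ℝ f x u i = d := by
  have hline : HasDerivAt (fun t : ℝ => x + t • u) u 0 := by
    simpa using ((hasDerivAt_id (0 : ℝ)).smul_const u).const_add x
  have h1 : HasFDerivAt f (fderiv ℝ f x) (x + (0 : ℝ) • u) := by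
    simpa using (hf.differentiable (by simp) x).hasFDerivAt
  exact ((EuclideanSpace.proj i : Space →L[ℝ] ℝ).hasFDerivAt.comp_hasDerivAt 0
    (h1.comp_hasDerivAt 0 hline)).unique h

theorem hasDerivAt_line (x u : SpinorSpace) (i : Fin 4) :
    HasDerivAt (fun t : ℝ => (x + t • u) i) (u i) 0 := by
  simpa using ((hasDerivAt_id (0 : ℝ)).mul_const (u i)).const_add (x i)

theorem fderiv_spinBase (x u : SpinorSpace) :
    fderiv ℝ spinBase x u 0 = 2 * (x 0 * u 0 + x 1 * u 1 - x 2 * u 2 - x 3 * u 3) ∧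
    fderiv ℝ spinBase x u 1 = 2 * (u 0 * x 2 + x 0 * u 2 - u 1 * x 3 - x 1 * u 3) ∧
    fderiv ℝ spinBase x u 2 = 2 * (u 0 * x 3 + x 0 * u 3 + u 1 * x 2 + x 1 * u 2) := by
  have h := hasDerivAt_line x u
  refine ⟨?_, ?_, ?_⟩ <;> refine fderiv_apply_of_hasDerivAt contDiff_spinBase ?_
  · refine (((((h 0).pow 2).add ((h 1).pow 2)).sub ((h 2).pow 2)).sub
      ((h 3).pow 2)).congr_deriv ?_
    simp; ring
  · refine ((((h 0).mul (h 2)).sub ((h 1).mul (h 3))).const_mul 2).congr_deriv ?_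
    simp; ring
  · refine ((((h 0).mul (h 3)).add ((h 1).mul (h 2))).const_mul 2).congr_deriv ?_
    simp; ring

theorem fderiv_spinFiber (x u : SpinorSpace) :
    fderiv ℝ spinFiber x u 0 = 2 * (u 0 * x 2 + x 0 * u 2 + u 1 * x 3 + x 1 * u 3) ∧
    fderiv ℝ spinFiber x u 1 = 2 * (x 2 * u 2 - x 3 * u 3 - x 0 * u 0 + x 1 * u 1) ∧
    fderiv ℝ spinFiber x u 2 = 2 * (u 2 * x 3 + x 2 * u 3 - u 0 * x 1 - x 0 * u 1) := by
  have h := hasDerivAt_line x u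
  refine ⟨?_, ?_, ?_⟩ <;> refine fderiv_apply_of_hasDerivAt contDiff_spinFiber ?_
  · refine ((((h 0).mul (h 2)).add ((h 1).mul (h 3))).const_mul 2).congr_deriv ?_
    simp; ring
  · refine (((((h 2).pow 2).sub ((h 3).pow 2)).sub ((h 0).pow 2)).add
      ((h 1).pow 2)).congr_deriv ?_
    simp; ring
  · refine ((((h 2).mul (h 3)).sub ((h 0).mul (h 1))).const_mul 2).congr_deriv ?_
    simp; ring

/-- The map from the sphere to the unit covectors is an immersion, and it remains one after the
covector has been multiplied by a function with value `r ≠ 0` and derivative `d`: the radial part of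
the derivative is orthogonal to the rest. -/
theorem eq_zero_of_fderiv_spin (x : ThreeSphere) {u : SpinorSpace} {r d : ℝ} (hr : r ≠ 0)
    (hb : fderiv ℝ spinBase x u = 0)
    (hf : r • fderiv ℝ spinFiber x u + d • spinFiber x = 0) : u = 0 := by
  have hx := threeSphere_sum_sq x
  obtain ⟨b0, b1, b2⟩ := fderiv_spinBase x u
  obtain ⟨f0, f1, f2⟩ := fderiv_spinFiber x u
  rw [hb] at b0 b1 b2
  simp only [PiLp.zero_apply] at b0 b1 b2
  have hxu : x.1 0 * u 0 + x.1 1 * u 1 + x.1 2 * u 2 + x.1 3 * u 3 = 0 := by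
    linear_combination -(x.1 0 * u 0 + x.1 1 * u 1 + x.1 2 * u 2 + x.1 3 * u 3) * hx -
      (x.1 0 ^ 2 + x.1 1 ^ 2 - x.1 2 ^ 2 - x.1 3 ^ 2) / 2 * b0 -
      (x.1 0 * x.1 2 - x.1 1 * x.1 3) * b1 - (x.1 0 * x.1 3 + x.1 1 * x.1 2) * b2
  have g0 := congrArg (fun w : Space => w 0) hf
  have g1 := congrArg (fun w : Space => w 1) hf
  have g2 := congrArg (fun w : Space => w 2) hf
  simp only [PiLp.add_apply, PiLp.smul_apply, PiLp.zero_apply, smul_eq_mul, f0, f1, f2,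
    spinFiber_zero, spinFiber_one, spinFiber_two] at g0 g1 g2
  -- `v · v̇ = 0` because `|v| = |x|²` and `x · u = 0`, so the radial part vanishes
  have hd : d = 0 := by
    linear_combination -d * (1 + (x.1 0 ^ 2 + x.1 1 ^ 2 + x.1 2 ^ 2 + x.1 3 ^ 2)) * hx
      + 2 * (x.1 0 * x.1 2 + x.1 1 * x.1 3) * g0
      + (x.1 2 ^ 2 - x.1 3 ^ 2 - x.1 0 ^ 2 + x.1 1 ^ 2) * g1
      + 2 * (x.1 2 * x.1 3 - x.1 0 * x.1 1) * g2
      - 2 * r * (x.1 0 ^ 2 + x.1 1 ^ 2 + x.1 2 ^ 2 + x.1 3 ^ 2) * hxu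
  rw [hd] at g0 g1 g2
  have k0 : u 0 * x.1 2 + x.1 0 * u 2 + u 1 * x.1 3 + x.1 1 * u 3 = 0 :=
    mul_left_cancel₀ hr (by linear_combination g0 / 2)
  have k1 : x.1 2 * u 2 - x.1 3 * u 3 - x.1 0 * u 0 + x.1 1 * u 1 = 0 :=
    mul_left_cancel₀ hr (by linear_combination g1 / 2)
  have k2 : u 2 * x.1 3 + x.1 2 * u 3 - u 0 * x.1 1 - x.1 0 * u 1 = 0 :=
    mul_left_cancel₀ hr (by linear_combination g2 / 2)
  -- four of the six linear equations decouple into equations for `(u₀, u₂)` and for `(u₁, u₃)`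
  have m0 : u 0 * (x.1 0 ^ 2 + x.1 2 ^ 2) = 0 := by
    linear_combination x.1 0 * (-b0 / 4 - k1 / 2) + x.1 2 * (-b1 / 4 + k0 / 2)
  have m2 : u 2 * (x.1 0 ^ 2 + x.1 2 ^ 2) = 0 := by
    linear_combination x.1 2 * (b0 / 4 + k1 / 2) + x.1 0 * (-b1 / 4 + k0 / 2)
  have m1 : u 1 * (x.1 1 ^ 2 + x.1 3 ^ 2) = 0 := by
    linear_combination x.1 1 * (-b0 / 4 + k1 / 2) + x.1 3 * (b1 / 4 + k0 / 2)
  have m3 : u 3 * (x.1 1 ^ 2 + x.1 3 ^ 2) = 0 := by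
    linear_combination x.1 3 * (b0 / 4 - k1 / 2) + x.1 1 * (b1 / 4 + k0 / 2)
  have hzero : ∀ {s t : ℝ}, s ^ 2 + t ^ 2 = 0 → s = 0 ∧ t = 0 := fun {s t} h => by
    constructor <;> refine pow_eq_zero_iff two_ne_zero |>.1 ?_ <;>
      linarith [sq_nonneg s, sq_nonneg t]
  by_cases hp : x.1 0 ^ 2 + x.1 2 ^ 2 = 0
  · obtain ⟨x0, x2⟩ := hzero hp
    rw [x0, x2] at b2 k2 hx
    have hq : x.1 1 ^ 2 + x.1 3 ^ 2 = 1 := by linarith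
    rw [hq, mul_one] at m1 m3
    refine spinor_ext ?_ m1 ?_ m3
    · linear_combination (norm := (simp; ring)) -u 0 * hq - x.1 3 * b2 / 2 - x.1 1 * k2
    · linear_combination (norm := (simp; ring)) -u 2 * hq - x.1 1 * b2 / 2 + x.1 3 * k2
  by_cases hq : x.1 1 ^ 2 + x.1 3 ^ 2 = 0
  · obtain ⟨x1, x3⟩ := hzero hq
    rw [x1, x3] at b2 k2 hx
    have hp' : x.1 0 ^ 2 + x.1 2 ^ 2 = 1 := by linarith
    rw [hp', mul_one] at m0 m2
    refine spinor_ext m0 ?_ m2 ?_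
    · linear_combination (norm := (simp; ring)) -u 1 * hp' - x.1 2 * b2 / 2 - x.1 0 * k2
    · linear_combination (norm := (simp; ring)) -u 3 * hp' - x.1 0 * b2 / 2 + x.1 2 * k2
  · exact spinor_ext ((mul_eq_zero.1 m0).resolve_right hp) ((mul_eq_zero.1 m1).resolve_right hq)
      ((mul_eq_zero.1 m2).resolve_right hp) ((mul_eq_zero.1 m3).resolve_right hq)

namespace TwoCenters

variable (P : TwoCenters)

/-! ### The parametrization of the regularized hypersurface -/

theorem exists_scale (x : ThreeSphere) :
    ∃ t : ℝ, 0 < t ∧ (spinBase x, t • spinFiber x) ∈ P.hypersurface :=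
  P.exists_smul_mem_hypersurface (spin_mem_cotangentSphere x) (spinFiber_ne_zero x)

/-- The length of the covector at which the ray through a unit covector meets the regularized
hypersurface. -/
noncomputable def scale (x : ThreeSphere) : ℝ := (P.exists_scale x).choose

theorem scale_pos (x : ThreeSphere) : 0 < P.scale x := (P.exists_scale x).choose_spec.1

/-- The parametrization of the regularized hypersurface by the three-sphere. -/
noncomputable def embedding (x : ThreeSphere) : Space × Space :=
  (spinBase x, P.scale x • spinFiber x)

theorem embedding_mem (x : ThreeSphere) : P.embedding x ∈ P.hypersurface :=
  (P.exists_scale x).choose_spec.2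

theorem scale_eq (x : ThreeSphere) {t : ℝ} (ht : 0 < t)
    (h : (spinBase x, t • spinFiber x) ∈ P.hypersurface) : P.scale x = t :=
  P.smul_mem_hypersurface_unique (spin_mem_cotangentSphere x) (P.scale_pos x) ht
    (P.embedding_mem x) h

theorem norm_embedding_snd (x : ThreeSphere) : ‖(P.embedding x).2‖ = P.scale x := by
  rw [embedding, norm_smul, norm_spinFiber, mul_one, Real.norm_of_nonneg (P.scale_pos x).le]

theorem range_embedding : Set.range P.embedding = P.hypersurface := by
  ext ⟨ξ, η⟩
  constructor
  · rintro ⟨x, hx⟩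
    rw [← hx]
    exact P.embedding_mem x
  · intro h
    have hη : 0 < ‖η‖ := norm_pos_iff.2 h.1.2.1
    have hsmul : ‖η‖ • (‖η‖⁻¹ • η) = η := smul_inv_smul₀ hη.ne' η
    obtain ⟨x, hx1, hx2⟩ := exists_spin_eq (smul_mem_cotangentSphere h.1.1 ‖η‖⁻¹)
      (by rw [norm_smul, norm_inv, norm_norm, inv_mul_cancel₀ hη.ne'])
    refine ⟨x, ?_⟩
    have hs : P.scale x = ‖η‖ := P.scale_eq x hη (by rwa [hx1, hx2, hsmul])
    rw [embedding, hs, hx1, hx2, hsmul]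

theorem embedding_eq_iff (x y : ThreeSphere) :
    P.embedding x = P.embedding y ↔ x = y ∨ x = -y := by
  constructor
  · intro h
    have hs : P.scale x = P.scale y := by rw [← norm_embedding_snd, h, norm_embedding_snd]
    refine eq_or_eq_neg_of_spin_eq (congrArg Prod.fst h) ?_
    have h2 : P.scale x • spinFiber x = P.scale y • spinFiber y := congrArg Prod.snd h
    rw [hs] at h2
    exact smul_right_injective _ (P.scale_pos y).ne' h2
  · rintro (h | h)
    · rw [h]
    · obtain ⟨h1, h2⟩ := spin_neg y
      have h3 : (x : SpinorSpace) = -(y : SpinorSpace) := by rw [h]; rfl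
      rw [← h3] at h1 h2
      have hs : P.scale x = P.scale y := by
        refine P.scale_eq x (P.scale_pos y) ?_
        rw [h1, h2]
        exact P.embedding_mem y
      rw [embedding, embedding, hs, h1, h2]

/-- Near each point the length of the covector is the restriction to the sphere of a smooth
function, by the implicit function theorem: the regularized Hamiltonian has positive derivative
along the rays. -/
theorem exists_smooth_scale (x : ThreeSphere) : ∃ φ : SpinorSpace → ℝ,
    ContDiffAt ℝ ∞ φ x ∧ ∀ᶠ y : ThreeSphere in 𝓝 x, P.scale y = φ y := by
  have hr := P.scale_pos x
  have hmem := P.embedding_mem x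
  set r := P.scale x with hrdef
  let g : SpinorSpace × ℝ → Space × Space := fun u => (spinBase u.1, u.2 • spinFiber u.1)
  have hg : ContDiff ℝ ∞ g :=
    (contDiff_spinBase.comp contDiff_fst).prodMk
      (contDiff_snd.smul (contDiff_spinFiber.comp contDiff_fst))
  have hgx : g (x, r) = P.embedding x := rfl
  have hK : ContDiffAt ℝ ∞ P.regularized (g (x, r)) := P.contDiffAt_regularized hmem.1.2
  have hG : ContDiffAt ℝ ∞ (P.regularized ∘ g) ((x : SpinorSpace), r) :=
    hK.comp _ hg.contDiffAt
  have hgd : fderiv ℝ g (x, r) (0, 1) = (0, spinFiber x) := by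
    have h1 : HasDerivAt (fun t : ℝ => g (x, t)) (fderiv ℝ g (x, r) (0, 1)) r :=
      ((hg.differentiable (by simp) _).hasFDerivAt).comp_hasDerivAt r
        ((hasDerivAt_const r (x : SpinorSpace)).prodMk (hasDerivAt_id r))
    have h2 : HasDerivAt (fun t : ℝ => g (x, t)) (0, spinFiber x) r := by
      have := (hasDerivAt_const r (spinBase x)).prodMk
        ((hasDerivAt_id r).smul_const (spinFiber x))
      simpa using this
    exact h1.unique h2
  have hd : fderiv ℝ (P.regularized ∘ g) ((x : SpinorSpace), r) (0, 1) ≠ 0 := by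
    rw [fderiv_comp _ (hK.differentiableAt (by simp)) (hg.differentiable (by simp) _),
      ContinuousLinearMap.comp_apply, hgd]
    intro h
    have hpos := P.fderiv_regularized_fiberField_pos hmem
    have hfield : fiberField (P.embedding x) = r • ((0 : Space), spinFiber x) := by
      rw [Prod.smul_mk, smul_zero]; rfl
    rw [hfield, map_smul, ← hgx, h, smul_zero] at hpos
    exact lt_irrefl _ hpos
  have hinv : (fderiv ℝ (P.regularized ∘ g) ((x : SpinorSpace), r) ∘L
      .inr ℝ SpinorSpace ℝ).IsInvertible := by
    refine ⟨ContinuousLinearEquiv.unitsEquivAut ℝ (Units.mk0 _ hd), ?_⟩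
    ext
    simp
  have hφ := hG.contDiffAt_implicitFunction (by simp) hinv
  set φ := hG.implicitFunction (by simp) hinv with hφdef
  have hφx : φ x = r := hG.implicitFunction_apply_self (by simp) hinv
  refine ⟨φ, hφ, ?_⟩
  have hcoe : Filter.Tendsto (fun y : ThreeSphere => (y : SpinorSpace)) (𝓝 x) (𝓝 x) :=
    continuous_subtype_val.tendsto x
  have hφc : Filter.Tendsto φ (𝓝 x) (𝓝 r) := by
    have := hφ.continuousAt.tendsto
    rwa [hφx] at this
  have hdom : ∀ᶠ y in 𝓝 (x : SpinorSpace), g (y, φ y) ∈ P.domain :=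
    (hg.continuous.tendsto (x, r)).comp (Filter.tendsto_id.prodMk_nhds hφc)
      |>.eventually (P.isOpen_domain.mem_nhds hmem.1.2)
  filter_upwards [hcoe.eventually (hG.eventually_apply_implicitFunction (by simp) hinv),
    hcoe.eventually hdom, hcoe.eventually (hφc.eventually (Ioi_mem_nhds hr))] with y h1 h2 h3
  refine P.scale_eq y h3 ⟨⟨smul_mem_cotangentSphere (spin_mem_cotangentSphere y) _, h2⟩, ?_⟩
  refine Eq.trans h1 ?_
  exact hmem.2

theorem embedding_contMDiff_and_injective_mfderiv (x : ThreeSphere) :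
    ContMDiffAt (𝓡 3) 𝓘(ℝ, Space × Space) ∞ P.embedding x ∧
      Function.Injective (mfderiv (𝓡 3) 𝓘(ℝ, Space × Space) P.embedding x) := by
  obtain ⟨φ, hφ, hev⟩ := P.exists_smooth_scale x
  let ψ : SpinorSpace → Space × Space := fun y => (spinBase y, φ y • spinFiber y)
  have hψ : ContDiffAt ℝ ∞ ψ x :=
    contDiff_spinBase.contDiffAt.prodMk (hφ.smul contDiff_spinFiber.contDiffAt)
  have heq : P.embedding =ᶠ[𝓝 x] ψ ∘ (Subtype.val : ThreeSphere → SpinorSpace) := by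
    filter_upwards [hev] with y hy
    simp only [embedding, hy, ψ, Function.comp_apply]
  have : Fact (Module.finrank ℝ SpinorSpace = 3 + 1) := ⟨by simp⟩
  have hcoe : ContMDiff (𝓡 3) 𝓘(ℝ, SpinorSpace) ∞ (Subtype.val : ThreeSphere → SpinorSpace) :=
    contMDiff_coe_sphere
  have hcoei : Function.Injective
      (mfderiv (𝓡 3) 𝓘(ℝ, SpinorSpace) (Subtype.val : ThreeSphere → SpinorSpace) x) := by
    convert! injective_mvfderiv_subtypeVal_sphere (n := 3) x
  refine ⟨(hψ.contMDiffAt.comp x (hcoe x)).congr_of_eventuallyEq heq, ?_⟩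
  rw [heq.mfderiv_eq, mfderiv_comp (I' := 𝓘(ℝ, SpinorSpace)) x
    (hψ.contMDiffAt.mdifferentiableAt (by simp)) ((hcoe x).mdifferentiableAt (by simp)),
    mfderiv_eq_fderiv]
  have hinj : Function.Injective (fderiv ℝ ψ x) := by
    rw [injective_iff_map_eq_zero]
    intro u hu
    have h1 : HasFDerivAt ψ _ (x : SpinorSpace) :=
      ((contDiff_spinBase.differentiable (by simp) _).hasFDerivAt).prodMk
        (((hφ.differentiableAt (by simp)).hasFDerivAt).smul
          ((contDiff_spinFiber.differentiable (by simp) _).hasFDerivAt))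
    rw [h1.fderiv] at hu
    refine eq_zero_of_fderiv_spin x (r := φ x) (d := fderiv ℝ φ x u) ?_ (congrArg Prod.fst hu) ?_
    · rw [← hev.self_of_nhds]
      exact (P.scale_pos x).ne'
    · exact congrArg Prod.snd hu
  exact hinj.comp hcoei

theorem continuous_embedding : Continuous P.embedding :=
  continuous_iff_continuousAt.2 fun x =>
    (P.embedding_contMDiff_and_injective_mfderiv x).1.continuousAt

theorem isCompact_hypersurface : IsCompact P.hypersurface := by
  rw [← range_embedding]
  exact isCompact_range P.continuous_embedding

/-- The regularized hypersurface is `ℝP³`, and the field `η ∂_η` is transverse to it. -/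
theorem exists_contact_structure :
    ∃ _ : ChartedSpace (EuclideanSpace ℝ (Fin 3)) P.hypersurface,
      IsEmbeddedSubmanifold P.hypersurface ∧
      Nonempty (Diffeomorph (𝓡 3) (𝓡 3) P.hypersurface RealProjectiveThreeSpace ∞) ∧
      IsRestrictedContactTypeWith P.hypersurface fiberField := by
  have h := exists_isEmbeddedSubmanifold_projective
    (fun x => (P.embedding_contMDiff_and_injective_mfderiv x).1) P.embedding_eq_iff
    fun x => (P.embedding_contMDiff_and_injective_mfderiv x).2
  rw [P.range_embedding] at h
  obtain ⟨hS, hsub, hdiff⟩ := h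
  refine ⟨hS, hsub, hdiff, fun w hw => hw.1.1, isLiouvilleField_fiberField, fun z hz => ?_⟩
  refine (P.fderiv_regularized_fiberField_pos z.2).ne' ?_
  exact fderiv_eq_zero_of_mem_tangentVectors hsub (fun w hw => hw.2) z
    ((P.contDiffAt_regularized z.2.1.2).differentiableAt (by simp)) hz

/-! ### The component of the energy hypersurface and its closure -/

theorem moserMap_image_component_eq :
    moserMap P.A '' P.component = P.embedding '' {x | spinBase x ≠ northPole} := by
  rw [moserMap_image_component, ← range_embedding]
  ext w
  constructor
  · rintro ⟨⟨x, rfl⟩, hx⟩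
    exact ⟨x, hx, rfl⟩
  · rintro ⟨x, hx, rfl⟩
    exact ⟨⟨x, rfl⟩, hx⟩

/-- The circle of collisions has dense complement in the three-sphere. -/
theorem dense_spinBase_ne_northPole : Dense {x : ThreeSphere | spinBase x ≠ northPole} := by
  intro x
  by_cases hx : x.1 2 ^ 2 + x.1 3 ^ 2 = 0
  · have hx2 : x.1 2 = 0 := by nlinarith [sq_nonneg (x.1 2), sq_nonneg (x.1 3)]
    have hx3 : x.1 3 = 0 := by nlinarith [sq_nonneg (x.1 2), sq_nonneg (x.1 3)]
    have hsum : x.1 0 ^ 2 + x.1 1 ^ 2 = 1 := by linarith [threeSphere_sum_sq x]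
    -- the great circle from `x` towards `(0, 0, 1, 0)`
    let γ : ℝ → ThreeSphere := fun t =>
      ⟨!₂[Real.cos t * x.1 0, Real.cos t * x.1 1, Real.sin t, 0], by
        rw [mem_sphere_zero_iff_norm, ← pow_eq_one_iff_of_nonneg (norm_nonneg _) two_ne_zero,
          spinor_norm_sq]
        change (Real.cos t * x.1 0) ^ 2 + (Real.cos t * x.1 1) ^ 2 + Real.sin t ^ 2 + 0 ^ 2 = 1
        linear_combination Real.cos t ^ 2 * hsum + Real.sin_sq_add_cos_sq t⟩
    have hγ : Continuous γ := by
      refine Continuous.subtype_mk ((PiLp.continuous_toLp 2 _).comp (continuous_pi fun i => ?_)) _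
      fin_cases i
      · exact Real.continuous_cos.mul continuous_const
      · exact Real.continuous_cos.mul continuous_const
      · exact Real.continuous_sin
      · exact continuous_const
    have hγ0 : γ 0 = x := by
      refine Subtype.ext (spinor_ext ?_ ?_ ?_ ?_)
      · change Real.cos 0 * x.1 0 = x.1 0
        simp
      · change Real.cos 0 * x.1 1 = x.1 1
        simp
      · change Real.sin 0 = x.1 2
        simp [hx2]
      · exact hx3.symm
    have hlim : Filter.Tendsto γ (𝓝[>] 0) (𝓝 x) := by
      have := (hγ.tendsto 0).mono_left (nhdsWithin_le_nhds (s := Set.Ioi 0))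
      rwa [hγ0] at this
    refine mem_closure_of_tendsto hlim ?_
    filter_upwards [Ioo_mem_nhdsGT Real.pi_pos] with t ht
    rw [spinBase_ne_northPole_iff]
    have : 0 < Real.sin t := Real.sin_pos_of_mem_Ioo ht
    change Real.sin t ^ 2 + 0 ^ 2 ≠ 0
    positivity
  · exact subset_closure ((spinBase_ne_northPole_iff x).2 hx)

theorem regularization_component : regularization P.A P.component = P.hypersurface := by
  rw [regularization]
  refine subset_antisymm ?_ ?_
  · refine closure_minimal ?_ P.isCompact_hypersurface.isClosed
    rw [moserMap_image_component]
    exact fun w hw => hw.1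
  · rw [moserMap_image_component_eq, ← range_embedding, ← Set.image_univ,
      ← dense_spinBase_ne_northPole.closure_eq]
    exact image_closure_subset_closure_image P.continuous_embedding

/-- The complement of the circle of collisions in the three-sphere is connected: it is the image of
`ℝ² × (ℝ² ∖ {0})` under normalization. -/
theorem isPreconnected_spinBase_ne_northPole :
    IsPreconnected {x : ThreeSphere | spinBase x ≠ northPole} := by
  have hrank : 1 < Module.rank ℝ Plane := by
    rw [rank_eq_card_basis (EuclideanSpace.basisFun (Fin 2) ℝ).toBasis]
    simp
  have hs : IsPreconnected ((Set.univ : Set Plane) ×ˢ ({0}ᶜ : Set Plane)) :=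
    isPreconnected_univ.prod (isConnected_compl_singleton_of_one_lt_rank hrank 0).isPreconnected
  have := Subtype.preconnectedSpace hs
  let g : Plane × Plane → SpinorSpace := fun u => !₂[u.1 0, u.1 1, u.2 0, u.2 1]
  have hg : Continuous g := by
    refine (PiLp.continuous_toLp 2 _).comp (continuous_pi fun i => ?_)
    fin_cases i
    · exact (by fun_prop : Continuous fun u : Plane × Plane => u.1 0)
    · exact (by fun_prop : Continuous fun u : Plane × Plane => u.1 1)
    · exact (by fun_prop : Continuous fun u : Plane × Plane => u.2 0)
    · exact (by fun_prop : Continuous fun u : Plane × Plane => u.2 1)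
  have hne : ∀ u : ((Set.univ : Set Plane) ×ˢ ({0}ᶜ : Set Plane)), g u ≠ 0 := by
    intro u h
    refine u.2.2 (plane_ext ?_ ?_)
    · exact congrArg (fun v : SpinorSpace => v 2) h
    · exact congrArg (fun v : SpinorSpace => v 3) h
  let n : ((Set.univ : Set Plane) ×ˢ ({0}ᶜ : Set Plane)) → ThreeSphere := fun u =>
    ⟨‖g u‖⁻¹ • g u, by
      rw [mem_sphere_zero_iff_norm, norm_smul, norm_inv, norm_norm,
        inv_mul_cancel₀ (norm_ne_zero_iff.2 (hne u))]⟩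
  have hgc : Continuous fun u : ((Set.univ : Set Plane) ×ˢ ({0}ᶜ : Set Plane)) => g u :=
    hg.comp continuous_subtype_val
  have hn : Continuous n :=
    ((hgc.norm.inv₀ fun u => norm_ne_zero_iff.2 (hne u)).smul hgc).subtype_mk _
  have hrange : Set.range n = {x : ThreeSphere | spinBase x ≠ northPole} := by
    ext x
    rw [Set.mem_ofPred_eq, spinBase_ne_northPole_iff]
    constructor
    · rintro ⟨u, rfl⟩
      have h1 := inv_ne_zero (norm_ne_zero_iff.2 (hne u))
      change (‖g u‖⁻¹ * u.1.2 0) ^ 2 + (‖g u‖⁻¹ * u.1.2 1) ^ 2 ≠ 0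
      rw [show (‖g u‖⁻¹ * u.1.2 0) ^ 2 + (‖g u‖⁻¹ * u.1.2 1) ^ 2 =
        (‖g u‖⁻¹ * ‖u.1.2‖) ^ 2 by rw [mul_pow _ ‖u.1.2‖, plane_norm_sq]; ring]
      exact pow_ne_zero 2 (mul_ne_zero h1 (norm_ne_zero_iff.2 u.2.2))
    · intro hx
      refine ⟨⟨(!₂[x.1 0, x.1 1], !₂[x.1 2, x.1 3]), Set.mem_univ _, ?_⟩, ?_⟩
      · intro h
        have h' : (!₂[x.1 2, x.1 3] : Plane) = 0 := h
        have h2 : x.1 2 = 0 := congrArg (fun v : Plane => v 0) h'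
        have h3 : x.1 3 = 0 := congrArg (fun v : Plane => v 1) h'
        rw [h2, h3] at hx
        simp at hx
      · have hgx : g (!₂[x.1 0, x.1 1], !₂[x.1 2, x.1 3]) = x := by
          refine spinor_ext ?_ ?_ ?_ ?_ <;> rfl
        refine Subtype.ext ?_
        change ‖g (!₂[x.1 0, x.1 1], !₂[x.1 2, x.1 3])‖⁻¹ • _ = _
        rw [hgx, norm_eq_of_mem_sphere x, inv_one, one_smul]
  rw [← hrange]
  exact isPreconnected_range hn

theorem isPreconnected_component : IsPreconnected P.component := by
  have h : P.component = moserInverse P.A '' (moserMap P.A '' P.component) := by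
    rw [Set.image_image]
    simp [moserInverse_moserMap]
  rw [h]
  refine IsPreconnected.image ?_ _ ((continuousOn_moserInverse P.A).mono ?_)
  · rw [moserMap_image_component_eq]
    exact isPreconnected_spinBase_ne_northPole.image _ P.continuous_embedding.continuousOn
  · rintro _ ⟨z, -, rfl⟩
    have := (ne_northPole_iff (moserMap_mem_cotangentSphere P.A z)).1
      (moserMap_fst_ne_northPole P.A z)
    exact (sub_pos.1 this).ne

/-- Close to `A` the potential is smaller than the energy, hence there are momenta of the given
energy. -/
theorem insert_fst_image_component_mem_nhds :
    insert P.A (Prod.fst '' P.component) ∈ 𝓝 P.A := by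
  have hpos : 0 < P.a / (|P.c| + 1) := div_pos P.ha (by positivity)
  refine Filter.mem_of_superset (ball_mem_nhds P.A (lt_min hpos P.radius_pos)) fun q hq => ?_
  rw [mem_ball, dist_eq_norm, lt_min_iff] at hq
  by_cases hqA : q = P.A
  · exact Or.inl hqA
  refine Or.inr ?_
  have hr : 0 < ‖q - P.A‖ := norm_pos_iff.2 (sub_ne_zero.2 hqA)
  have h1 : |P.c| + 1 ≤ P.a / ‖q - P.A‖ := by
    rw [le_div_iff₀ hr, mul_comm]
    exact ((lt_div_iff₀ (by positivity)).1 hq.1).le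
  have h2 : 0 ≤ P.b / ‖q - P.B‖ := div_nonneg P.hb.le (norm_nonneg _)
  have h3 : 0 ≤ P.c + P.a / ‖q - P.A‖ + P.b / ‖q - P.B‖ := by linarith [neg_abs_le P.c]
  refine ⟨(q, !₂[√(2 * (P.c + P.a / ‖q - P.A‖ + P.b / ‖q - P.B‖)), 0]), ⟨hqA, hq.2, ?_⟩, rfl⟩
  rw [hamiltonian, plane_norm_sq]
  change (√(2 * (P.c + P.a / ‖q - P.A‖ + P.b / ‖q - P.B‖)) ^ 2 + 0 ^ 2) / 2 - _ - _ = _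
  rw [Real.sq_sqrt (by positivity)]
  ring

theorem component_nonempty : P.component.Nonempty := by
  by_contra h
  rw [Set.not_nonempty_iff_eq_empty] at h
  have := P.insert_fst_image_component_mem_nhds
  rw [h, Set.image_empty] at this
  have h2 := interior_singleton P.A
  simp only [insert_empty_eq] at this
  rw [← mem_interior_iff_mem_nhds, h2] at this
  exact this

theorem ne_other_of_mem_component {z : Phase} (hz : z ∈ P.component) : z.1 ≠ P.B := by
  intro h
  have := hz.2.1
  rw [h, norm_sub_rev, P.hAB] at this
  linarith [P.radius_lt_one]

/-- The field `(q - A) ∂_q` is transverse to the component, because Moser's map carries it to the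
field `η ∂_η`, along which the regularized Hamiltonian increases. -/
theorem fderiv_hamiltonian_centralField_ne_zero {z : Phase} (hz : z ∈ P.component) :
    fderiv ℝ P.hamiltonian z (centralField P.A z) ≠ 0 := by
  have hzA : z.1 - P.A ≠ 0 := sub_ne_zero.2 hz.1
  have hzB : z.1 - P.B ≠ 0 := sub_ne_zero.2 (P.ne_other_of_mem_component hz)
  have hmem : moserMap P.A z ∈ P.hypersurface := by
    have : moserMap P.A z ∈ moserMap P.A '' P.component := ⟨z, hz, rfl⟩
    rw [moserMap_image_component] at this
    exact this.1
  have hnA : DifferentiableAt ℝ (fun z : Phase => ‖z.1 - P.A‖) z :=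
    (differentiableAt_fst.sub_const P.A).norm ℝ hzA
  have hnB : DifferentiableAt ℝ (fun z : Phase => ‖z.1 - P.B‖) z :=
    (differentiableAt_fst.sub_const P.B).norm ℝ hzB
  have hdA : DifferentiableAt ℝ (fun z : Phase => P.a / ‖z.1 - P.A‖) z :=
    (hnA.inv (norm_ne_zero_iff.2 hzA)).const_mul P.a
  have hdB : DifferentiableAt ℝ (fun z : Phase => P.b / ‖z.1 - P.B‖) z :=
    (hnB.inv (norm_ne_zero_iff.2 hzB)).const_mul P.b
  have hdp : DifferentiableAt ℝ (fun z : Phase => ‖z.2‖ ^ 2 / 2) z :=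
    (differentiableAt_snd.norm_sq ℝ).mul_const 2⁻¹
  have hH : DifferentiableAt ℝ P.hamiltonian z := (hdp.sub hdA).sub hdB
  have hev : (P.regularized ∘ moserMap P.A) =ᶠ[𝓝 z]
      fun z => ‖z.1 - P.A‖ * (P.hamiltonian z - P.c) := by
    filter_upwards [(isOpen_ne_fun continuous_fst continuous_const).mem_nhds hz.1] with w hw
    exact P.regularized_moserMap hw
  have h1 := P.fderiv_regularized_fiberField_pos hmem
  rw [← fderiv_moserMap_centralField, ← ContinuousLinearMap.comp_apply,
    ← fderiv_comp z ((P.contDiffAt_regularized hmem.1.2).differentiableAt (by simp))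
      ((contDiff_moserMap P.A).differentiable (by simp) z), hev.fderiv_eq,
    fderiv_fun_mul hnA (hH.sub_const P.c), hz.2.2, sub_self, zero_smul, add_zero,
    fderiv_sub_const] at h1
  intro h0
  rw [smul_apply, h0, smul_zero] at h1
  exact lt_irrefl _ h1

theorem isRegularized {μ : ℝ} (hH : energy μ = P.hamiltonian)
    (hA : ∀ q : Plane, q ≠ earth → q ≠ moon → q ≠ P.A) :
    IsRegularized μ P.c P.A P.component where
  smooth := contDiff_moserMap P.A
  injective := injective_moserMap P.A
  range_eq := range_moserMap P.A
  symplectic := moserMap_symplectic P.A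
  compact := by
    rw [regularization_component]
    exact P.isCompact_hypersurface
  subset := by
    rw [regularization_component]
    exact fun w hw => hw.1.1
  image_eq := by
    rw [regularization_component]
    exact P.moserMap_image_component
  hamiltonian := by
    rw [regularization_component, hH]
    refine ⟨P.domain, P.regularized, P.isOpen_domain, P.contDiffOn_regularized, rfl,
      fun w hw => ⟨fiberField w, (isLiouvilleField_fiberField.2 w hw.1.1).1,
        (P.fderiv_regularized_fiberField_pos hw).ne'⟩, fun z h1 h2 _ => ?_⟩
    exact P.regularized_moserMap (hA z.1 h1 h2)

theorem isContactProjectiveSpace {μ : ℝ} (hH : energy μ = P.hamiltonian)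
    (hA : ∀ q : Plane, q ≠ earth → q ≠ moon → q ≠ P.A) :
    IsContactProjectiveSpace μ P.c P.A P.component where
  regularized := P.isRegularized hH hA
  liouville := isLiouvilleField_centralField P.A _
  transverse := by
    rw [hH]
    exact fun z hz => P.fderiv_hamiltonian_centralField_ne_zero hz
  extends_field := fderiv_moserMap_centralField P.A
  starShaped := by
    rw [regularization_component]
    exact P.isFiberwiseStarShaped_hypersurface
  contact := by
    rw [regularization_component]
    exact P.exists_contact_structure

/-- At the energy `c` no position is as far from `A` as the critical point and as far from `B` as
the critical point. -/
theorem norm_lt_or_norm_lt {z : Phase} (hc : P.hamiltonian z = P.c) :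
    ‖z.1 - P.A‖ < P.radius ∨ ‖z.1 - P.B‖ < 1 - P.radius := by
  by_contra! h
  have hR := P.radius_pos
  have hR' : 0 < 1 - P.radius := by linarith [P.radius_lt_one]
  have ha := P.ha
  have hb := P.hb
  have h1 : P.a / ‖z.1 - P.A‖ ≤ P.a / P.radius := by gcongr; exact h.1
  have h2 : P.b / ‖z.1 - P.B‖ ≤ P.b / (1 - P.radius) := by gcongr; exact h.2
  have h3 := P.energy_lt_at_radius
  rw [hamiltonian] at hc
  linarith [sq_nonneg ‖z.2‖]

/-- The same problem, seen from the other center. -/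
noncomputable def swap : TwoCenters where
  A := P.B
  B := P.A
  a := P.b
  b := P.a
  c := P.c
  ha := P.hb
  hb := P.ha
  hAB := by rw [norm_sub_rev, P.hAB]
  hc := by rw [add_comm √P.b]; exact P.hc

theorem hamiltonian_swap : P.swap.hamiltonian = P.hamiltonian :=
  funext fun _ => sub_right_comm _ _ _

theorem radius_swap : P.swap.radius = 1 - P.radius := by
  rw [one_sub_radius, radius, add_comm]
  rfl

/-- The balls that contain the two components are disjoint: they touch at the critical point. -/
theorem not_norm_lt_and_norm_lt (q : Plane) :
    ¬ (‖q - P.A‖ < P.radius ∧ ‖q - P.B‖ < 1 - P.radius) := by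
  rintro ⟨h1, h2⟩
  have := norm_sub_le (q - P.B) (q - P.A)
  rw [sub_sub_sub_cancel_left, P.hAB] at this
  linarith

end TwoCenters

/-- Two disjoint connected pieces that are separated by open sets are the components of their
union. -/
theorem componentsOf_union {X : Type*} [TopologicalSpace X] {C D U V : Set X}
    (hC : IsPreconnected C) (hD : IsPreconnected D) (hC0 : C.Nonempty) (hD0 : D.Nonempty)
    (hU : IsOpen U) (hV : IsOpen V) (hUV : Disjoint U V) (hCU : C ⊆ U) (hDV : D ⊆ V) :
    componentsOf (C ∪ D) = {C, D} := by
  have key : ∀ {C D U V : Set X}, IsPreconnected C → IsOpen U → IsOpen V → Disjoint U V →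
      C ⊆ U → D ⊆ V → ∀ x ∈ C, connectedComponentIn (C ∪ D) x = C := by
    intro C D U V hC hU hV hUV hCU hDV x hx
    refine subset_antisymm ?_ (hC.subset_connectedComponentIn hx Set.subset_union_left)
    have hsub := connectedComponentIn_subset (C ∪ D) x
    have hU' : connectedComponentIn (C ∪ D) x ⊆ U :=
      isPreconnected_connectedComponentIn.subset_left_of_subset_union hU hV hUV
        (hsub.trans (Set.union_subset_union hCU hDV))
        ⟨x, mem_connectedComponentIn (Or.inl hx), hCU hx⟩
    intro y hy
    rcases hsub hy with h | h
    · exact h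
    · exact absurd (hDV h) (Set.disjoint_left.1 hUV (hU' hy))
  ext S
  constructor
  · rintro ⟨x, hx | hx, rfl⟩
    · exact Or.inl (key hC hU hV hUV hCU hDV x hx)
    · rw [Set.union_comm]
      exact Or.inr (key hD hV hU hUV.symm hDV hCU x hx)
  · rintro (rfl | rfl)
    · obtain ⟨x, hx⟩ := hC0
      exact ⟨x, Or.inl hx, (key hC hU hV hUV hCU hDV x hx).symm⟩
    · obtain ⟨x, hx⟩ := hD0
      refine ⟨x, Or.inr hx, ?_⟩
      rw [Set.union_comm]
      exact (key hD hV hU hUV.symm hDV hCU x hx).symm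

end EulerProblem

theorem propositionB1 (μ c : ℝ) (hμ₀ : 0 < μ) (hμ₁ : μ < 1)
    (hc : c < EulerProblem.jacobiEnergy μ) :
    ∃ CE CM : Set EulerProblem.Phase,
      CE ≠ CM ∧
      EulerProblem.componentsOf (EulerProblem.energyHypersurface μ c) = {CE, CM} ∧
      insert EulerProblem.earth (Prod.fst '' CE) ∈ 𝓝 EulerProblem.earth ∧
      insert EulerProblem.moon (Prod.fst '' CM) ∈ 𝓝 EulerProblem.moon ∧
      EulerProblem.IsContactProjectiveSpace μ c EulerProblem.earth CE ∧
      EulerProblem.IsContactProjectiveSpace μ c EulerProblem.moon CM := by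
  let P : EulerProblem.TwoCenters :=
    { A := EulerProblem.earth
      B := EulerProblem.moon
      a := 1 - μ
      b := μ
      c := c
      ha := sub_pos.2 hμ₁
      hb := hμ₀
      hAB := by
        refine (pow_eq_one_iff_of_nonneg (norm_nonneg _) two_ne_zero).1 ?_
        rw [EulerProblem.plane_norm_sq]
        simp [EulerProblem.earth, EulerProblem.moon]
        norm_num
      hc := by
        have h1 : √(1 - μ) ^ 2 = 1 - μ := Real.sq_sqrt (sub_pos.2 hμ₁).le
        have h2 : √μ ^ 2 = μ := Real.sq_sqrt hμ₀.le
        have h3 : √(μ * (1 - μ)) = √μ * √(1 - μ) := Real.sqrt_mul hμ₀.le _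
        rw [EulerProblem.jacobiEnergy, h3] at hc
        linarith [add_sq √(1 - μ) √μ] }
  have hH : EulerProblem.energy μ = P.hamiltonian := rfl
  have hHs : EulerProblem.energy μ = P.swap.hamiltonian := hH.trans P.hamiltonian_swap.symm
  have hopen : ∀ (A : EulerProblem.Plane) (r : ℝ),
      IsOpen {z : EulerProblem.Phase | ‖z.1 - A‖ < r} := fun A r =>
    isOpen_lt (continuous_fst.sub continuous_const).norm continuous_const
  have hdisj : Disjoint {z : EulerProblem.Phase | ‖z.1 - P.A‖ < P.radius}
      {z | ‖z.1 - P.B‖ < 1 - P.radius} :=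
    Set.disjoint_left.2 fun z h1 h2 => P.not_norm_lt_and_norm_lt z.1 ⟨h1, h2⟩
  have hCE : P.component ⊆ {z | ‖z.1 - P.A‖ < P.radius} := fun z hz => hz.2.1
  have hCM : P.swap.component ⊆ {z | ‖z.1 - P.B‖ < 1 - P.radius} := fun z hz => by
    rw [← P.radius_swap]
    exact hz.2.1
  have hunion : EulerProblem.energyHypersurface μ c = P.component ∪ P.swap.component := by
    ext z
    constructor
    · rintro ⟨h1, h2, h3⟩
      rcases P.norm_lt_or_norm_lt (z := z) h3 with h | h
      · exact Or.inl ⟨h1, h, h3⟩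
      · refine Or.inr ⟨h2, ?_, ?_⟩
        · rw [P.radius_swap]
          exact h
        · rw [← hHs]
          exact h3
    · rintro (h | h)
      · exact ⟨h.1, P.ne_other_of_mem_component h, h.2.2⟩
      · refine ⟨P.swap.ne_other_of_mem_component h, h.1, ?_⟩
        rw [hHs]
        exact h.2.2
  refine ⟨P.component, P.swap.component, ?_, ?_, P.insert_fst_image_component_mem_nhds,
    P.swap.insert_fst_image_component_mem_nhds, P.isContactProjectiveSpace hH fun q h _ => h,
    P.swap.isContactProjectiveSpace hHs fun q _ h => h⟩
  · intro h
    obtain ⟨z, hz⟩ := P.component_nonempty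
    exact Set.disjoint_left.1 hdisj (hCE hz) (hCM (h ▸ hz))
  · rw [hunion]
    exact EulerProblem.componentsOf_union P.isPreconnected_component
      P.swap.isPreconnected_component P.component_nonempty P.swap.component_nonempty
      (hopen _ _) (hopen _ _) hdisj hCE hCM
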